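/- A tensor-triangulated category is a triangulated category with a closed symmetric monoidal structure $(\otimes,\mathbb 1,[-,-])$ whose tensor product is exact in each variable, compatibly with suspension. An object $t$ of a triangulated category is compact if $\mathrm{Hom}(t,-)$ preserves coproducts; an object $x$ of a tensor-triangulated category is rigid if the natural map $[x,\mathbb 1]\otimes y\to[x,y]$ is an isomorphism for all $y$. The category is rigidly-compactly generated if it has all small coproducts, there is a set $\mathcal G$ of compact objects such that $\mathrm{Hom}(g,t)=0$ for all $g\in\mathcal G$ implies $t=0$, and the compact objects are exactly the rigid objects. **Theorem (Grothendieck–Neeman duality).** Let $\mathcal C$ and $\mathcal D$ be rigidly-compactly generated tensor-triangulated categories and let $f^*:\mathcal D\to\mathcal C$ be an exact strong symmetric monoidal functor that preserves coproducts. Then $f^*$ has a right adjoint $f_*$, which has a right adjoint $f^{(1)}$, and the canonical map $\pi: x\otimes f_*(y)\to f_*(f^*(x)\otimes y)$, adjoint to $f^*(x\otimes f_*y)\cong f^*x\otimes f^*f_*y\to f^*x\otimes y$, is an isomorphism, natural in $x\in\mathcal D$ and $y\in\mathcal C$. Put $\omega=f^{(1)}(\mathbb 1)$. The following conditions are equivalent: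 (a) $f^*$ has a left adjoint $f_{(1)}$; (b) $f^*$ preserves products; (c) $f^{(1)}$ has a right adjoint $f_{(-1)}$; (d) $f^{(1)}$ preserves coproducts; (e) $f_*$ preserves compact objects; (f) there is a natural isomorphism $\omega\otimes f^*(-)\cong f^{(1)}(-)$. If these hold, the adjoints $f_{(1)}\dashv f^*\dashv f_*\dashv f^{(1)}\dashv f_{(-1)}$ satisfy the following relations, given by canonical isomorphisms that are natural in all variables: 1. $\omega\otimes f^*(-)\cong f^{(1)}(-)$ (Grothendieck duality); 2. $f_{(-1)}\cong f_*[\omega,-]$; 3. $f^{(1)}(x)\otimes f^*(y)\cong f^{(1)}(x\otimes y)$; 4. $[x,f_{(-1)}y]\cong f_*[f^{(1)}x,y]$; 5. $[x,f_{(-1)}y]\cong f_{(-1)}[f^*x,y]$; 6. $f^*(-)\cong[\omega,f^{(1)}(-)]$; 7. $f_*(\omega\otimes-)\cong f_{(1)}(-)$ (ur-Wirthmüller isomorphism); 8. $x\otimes f_{(1)}(y)\cong f_{(1)}(f^*(x)\otimes y)$ (left projection formula); 9. $f^*[x,y]\cong[f^*x,f^*y]$; 10. $[f_{(1)}x,y]\cong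 f_*[x,f^*y]$; 11. $f_{(1)}(f^*x\otimes y)\cong f_*(f^{(1)}x\otimes y)$; 12. $[f^*x,f^*y]\cong[f^{(1)}x,f^{(1)}y]$; 13. $f_*[x,f^*y]\cong f_{(-1)}[x,f^{(1)}y]$; 14. $f^*\cong[\omega,\omega\otimes f^*(-)]$; 15. $\mathbb 1\cong[\omega,\omega]$. Here the canonical isomorphisms are the following. (3) is adjoint to $f_*(f^{(1)}x\otimes f^*y)\cong f_*f^{(1)}x\otimes y\to x\otimes y$, the inverse of $\pi$ (up to symmetry) followed by the counit of $f_*\dashv f^{(1)}$, and (1) is (3) at $x=\mathbb 1$. (7) is the composite $f_*(\omega\otimes x)\cong f_*(x\otimes\omega)\to f_*(f^*f_{(1)}x\otimes\omega)\cong f_{(1)}x\otimes f_*\omega\to f_{(1)}x$ of the unit of $f_{(1)}\dashv f^*$, $\pi^{-1}$, and the counit $f_*f^{(1)}\mathbb 1\to\mathbb 1$. (8) corresponds to $\pi$ under (7), and (11) is composed from (7) and (1). (2), (4), (5), (6) are obtained by passing to right adjoints in (1), in (3) with the first variable fixed, in (3) with the second variable fixed, and in (7), respectively; (9) and (10), and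 likewise (12) and (13), are obtained by passing to right adjoints in (8), respectively (11), with the variable in $\mathcal D$, respectively in $\mathcal C$, fixed. (14) is composed from (6) and (1), and (15) is (6) at $\mathbb 1$. -/

import Mathlib

open CategoryTheory Limits MonoidalCategory Opposite

universe v u u₁ u₂

noncomputable section

namespace GNDuality

section Categories

variable (C : Type u) [Category.{v} C]

variable {C} in
/-- The associator `(X ⊗ Y) ⊗ Z ⟶ X ⊗ (Y ⊗ Z)`, as a natural transformation in `Y`. -/
def middleAssociator [MonoidalCategory C] (X Z : C) :
    tensorLeft X ⋙ tensorRight Z ⟶ tensorRight Z ⋙ tensorLeft X where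
  app Y := (α_ X Y Z).hom

/-- A tensor-triangulated category: a triangulated category with a closed symmetric monoidal
structure, such that the tensor product is additive and exact in both variables, and such that the
suspension isomorphisms `X⟦m⟧ ⊗ Y ≅ (X ⊗ Y)⟦m⟧` and `X ⊗ Y⟦n⟧ ≅ (X ⊗ Y)⟦n⟧` (natural in both
variables, commuting with each other up to the sign `(-1) ^ (m * n)`: this is the instance argument
`CommShift₂Int`) are compatible with the unitors, the associator and the symmetry. -/
class TensorTriangulated [HasZeroObject C] [Preadditive C] [HasShift C ℤ]
    [∀ n : ℤ, (shiftFunctor C n).Additive] [Pretriangulated C] [IsTriangulated C]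
    [MonoidalCategory C] [SymmetricCategory C] [MonoidalClosed C] [MonoidalPreadditive C]
    [(curriedTensor C).CommShift₂Int] : Prop where
  tensorLeft_isTriangulated (X : C) : (tensorLeft X).IsTriangulated
  tensorRight_isTriangulated (X : C) : (tensorRight X).IsTriangulated
  leftUnitor_commShift : NatTrans.CommShift (leftUnitorNatIso C).hom ℤ
  rightUnitor_commShift : NatTrans.CommShift (rightUnitorNatIso C).hom ℤ
  braiding_commShift (X : C) :
    NatTrans.CommShift (BraidedCategory.tensorLeftIsoTensorRight X).hom ℤ
  associator_commShift₁ (Y Z : C) : NatTrans.CommShift (tensorRightTensor Y Z).hom ℤ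
  associator_commShift₂ (X Z : C) : NatTrans.CommShift (middleAssociator X Z) ℤ
  associator_commShift₃ (X Y : C) : NatTrans.CommShift (tensorLeftTensor X Y).hom ℤ

variable {C}

/-- The functor `F` preserves arbitrary (small) coproducts. -/
def PreservesCoproducts {E : Type u₁} [Category.{v} E] {E' : Type u₂} [Category.{v} E']
    (F : E ⥤ E') : Prop :=
  ∀ J : Type v, PreservesColimitsOfShape (Discrete J) F

/-- The functor `F` preserves arbitrary (small) products. -/
def PreservesProducts {E : Type u₁} [Category.{v} E] {E' : Type u₂} [Category.{v} E']
    (F : E ⥤ E') : Prop :=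
  ∀ J : Type v, PreservesLimitsOfShape (Discrete J) F

/-- `t` is compact: `Hom(t, -) : C ⥤ Ab` preserves arbitrary coproducts. -/
def IsCompactObj [Preadditive C] (t : C) : Prop :=
  ∀ J : Type v, PreservesColimitsOfShape (Discrete J) (preadditiveCoyoneda.obj (op t))

variable (C) in
/-- `C` has arbitrary coproducts and there is a set of compact objects `G` such that
`Hom(G, t) = 0` implies `t = 0`. -/
def IsCompactlyGenerated [Preadditive C] : Prop :=
  HasCoproducts.{v} C ∧ ∃ (ι : Type v) (G : ι → C), (∀ i, IsCompactObj (G i)) ∧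
    ∀ t : C, (∀ (i : ι) (φ : G i ⟶ t), φ = 0) → IsZero t

section

variable [MonoidalCategory C] [MonoidalClosed C]

/-- The natural map `[x, 𝟙] ⊗ y ⟶ [x, y]`. -/
def rigidMap (x y : C) : (ihom x).obj (𝟙_ C) ⊗ y ⟶ (ihom x).obj y :=
  MonoidalClosed.curry
    ((α_ x ((ihom x).obj (𝟙_ C)) y).inv ≫ (ihom.ev x).app (𝟙_ C) ▷ y ≫ (λ_ y).hom)

/-- `x` is rigid (strongly dualizable). -/
def IsRigidObj (x : C) : Prop := ∀ y : C, IsIso (rigidMap x y)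

variable (C) in
/-- Compactly generated, with compact objects and rigid objects coinciding. -/
def IsRigidlyCompactlyGenerated [Preadditive C] : Prop :=
  IsCompactlyGenerated C ∧ ∀ x : C, IsCompactObj x ↔ IsRigidObj x

/-- The adjunction `- ⊗ x ⊣ [x, -]` in a closed symmetric monoidal category. -/
def tensorRightAdj [SymmetricCategory C] (x : C) : tensorRight x ⊣ ihom x :=
  (ihom.adjunction x).ofNatIsoLeft (BraidedCategory.tensorLeftIsoTensorRight x)

end

end Categories

/-! Throughout, `F` is `f^*`, `G` is `f_*`, `H` is `f^{(1)}`, `L` is `f_{(1)}`, `K` is `f_{(-1)}`,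
so that `L ⊣ F ⊣ G ⊣ H ⊣ K`. -/

section Functors

variable {C : Type u₁} [Category.{v} C] [MonoidalCategory C] [SymmetricCategory C]
  [MonoidalClosed C]
  {D : Type u₂} [Category.{v} D] [MonoidalCategory D] [SymmetricCategory D] [MonoidalClosed D]
  {F : D ⥤ C} {G : C ⥤ D} {H : D ⥤ C} {L K : C ⥤ D}

/-- The projection map `x ⊗ f_* y ⟶ f_* (f^* x ⊗ y)`, adjoint to
`f^* (x ⊗ f_* y) ≅ f^* x ⊗ f^* f_* y ⟶ f^* x ⊗ y`. -/
def projMap [F.Braided] (adj₁ : F ⊣ G) (x : D) (y : C) :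
    x ⊗ G.obj y ⟶ G.obj (F.obj x ⊗ y) :=
  adj₁.homEquiv _ _ (Functor.OplaxMonoidal.δ F x (G.obj y) ≫ F.obj x ◁ adj₁.counit.app y)

variable (F G) in
/-- The type of isomorphisms `x ⊗ f_* y ≅ f_* (f^* x ⊗ y)` natural in `x : D` and `y : C`. -/
abbrev ProjIso : Type _ :=
  curriedTensor D ⋙ (Functor.whiskeringLeft C D D).obj G ≅
    F ⋙ curriedTensor C ⋙ (Functor.whiskeringRight C C D).obj G

variable (H) in
/-- The relative dualizing object `ω = f^{(1)}(𝟙)`. -/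
abbrev dualizingObj : C := H.obj (𝟙_ D)

/-- The comparison map `f^{(1)} x ⊗ f^* y ⟶ f^{(1)} (x ⊗ y)`, adjoint to
`f_* (f^{(1)} x ⊗ f^* y) ≅ f_* f^{(1)} x ⊗ y ⟶ x ⊗ y`
(projection formula followed by the counit). -/
def genGrothMap (π : ProjIso F G) (adj₂ : G ⊣ H) (x y : D) :
    H.obj x ⊗ F.obj y ⟶ H.obj (x ⊗ y) :=
  adj₂.homEquiv _ _
    (G.map (β_ (H.obj x) (F.obj y)).hom ≫ (π.inv.app y).app (H.obj x) ≫
      (β_ y (G.obj (H.obj x))).hom ≫ adj₂.counit.app x ▷ y)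

/-- The case `x = 𝟙` of the previous map, `ω ⊗ f^* y ⟶ f^{(1)} (𝟙 ⊗ y) ≅ f^{(1)} y`. -/
def grothMap (π : ProjIso F G) (adj₂ : G ⊣ H) (y : D) :
    dualizingObj H ⊗ F.obj y ⟶ H.obj y :=
  genGrothMap π adj₂ (𝟙_ D) y ≫ H.map (λ_ y).hom

/-- The ur-Wirthmüller map: the composite
`f_* (ω ⊗ x) ≅ f_* (x ⊗ ω) ⟶ f_* (f^* f_{(1)} x ⊗ ω) ≅ f_{(1)} x ⊗ f_* f^{(1)} 𝟙 ⟶ f_{(1)} x`. -/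
def urWirthMap (π : ProjIso F G) (adj₀ : L ⊣ F) (adj₂ : G ⊣ H) (x : C) :
    G.obj (dualizingObj H ⊗ x) ⟶ L.obj x :=
  G.map (β_ (dualizingObj H) x).hom ≫ G.map (adj₀.unit.app x ▷ dualizingObj H) ≫
    (π.inv.app (L.obj x)).app (dualizingObj H) ≫
    L.obj x ◁ adj₂.counit.app (𝟙_ D) ≫ (ρ_ (L.obj x)).hom

/-- The permutation `f^* x ⊗ (ω ⊗ y) ≅ ω ⊗ (f^* x ⊗ y)`. -/
def swapIso (a b c : C) : a ⊗ (b ⊗ c) ≅ b ⊗ (a ⊗ c) :=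
  (α_ a b c).symm ≪≫ whiskerRightIso (β_ a b) c ≪≫ α_ b a c

open Functor MonoidalClosed in
/-- The canonical natural isomorphisms relating `f_{(1)} ⊣ f^* ⊣ f_* ⊣ f^{(1)} ⊣ f_{(-1)}`.
Each isomorphism is natural in all its variables, and a second field says which one it is: an
explicit map, a composite of previous ones, or the conjugate of a previous one, obtained by passing
to right adjoints (`conjugateEquiv`), for two-variable formulas with one variable fixed. -/
structure DualityIsos [F.Braided] (π : ProjIso F G) (adj₀ : L ⊣ F) (adj₁ : F ⊣ G) (adj₂ : G ⊣ H)
    (adj₃ : H ⊣ K) where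
  /-- Grothendieck duality `ω ⊗ f^* ≅ f^{(1)}`. -/
  groth : F ⋙ tensorLeft (dualizingObj H) ≅ H
  groth_hom (y : D) : groth.hom.app y = grothMap π adj₂ y
  /-- `f_{(-1)} ≅ f_* [ω, -]`. -/
  coGroth : K ≅ ihom (dualizingObj H) ⋙ G
  coGroth_hom : coGroth.hom =
    conjugateEquiv adj₃ (adj₁.comp (ihom.adjunction (dualizingObj H))) groth.hom
  /-- `f^{(1)} x ⊗ f^* y ≅ f^{(1)} (x ⊗ y)`. -/
  genGroth : H ⋙ curriedTensor C ⋙ (whiskeringLeft D C C).obj F ≅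
    curriedTensor D ⋙ (whiskeringRight D D C).obj H
  genGroth_hom (x y : D) : (genGroth.hom.app x).app y = genGrothMap π adj₂ x y
  /-- `[x, f_{(-1)} y] ≅ f_* [f^{(1)} x, y]`. -/
  genCoGroth : internalHom ⋙ (whiskeringLeft C D D).obj K ≅
    H.op ⋙ internalHom ⋙ (whiskeringRight C C D).obj G
  genCoGroth_hom (x : D) : genCoGroth.hom.app (op x) =
    conjugateEquiv ((ihom.adjunction x).comp adj₃)
      (adj₁.comp (ihom.adjunction (H.obj x))) (genGroth.hom.app x)
  /-- `[x, f_{(-1)} y] ≅ f_{(-1)} [f^* x, y]`. -/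
  pseudoInthom : internalHom ⋙ (whiskeringLeft C D D).obj K ≅
    F.op ⋙ internalHom ⋙ (whiskeringRight C C D).obj K
  pseudoInthom_hom (x : D) : pseudoInthom.hom.app (op x) =
    conjugateEquiv ((tensorRightAdj x).comp adj₃)
      (adj₃.comp (tensorRightAdj (F.obj x))) (genGroth.hom.flipApp x)
  /-- The ur-Wirthmüller isomorphism `f_* (ω ⊗ -) ≅ f_{(1)}`. -/
  urWirth : tensorLeft (dualizingObj H) ⋙ G ≅ L
  urWirth_hom (x : C) : urWirth.hom.app x = urWirthMap π adj₀ adj₂ x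
  /-- `f^* ≅ [ω, f^{(1)} -]`. -/
  coWirth : F ≅ H ⋙ ihom (dualizingObj H)
  coWirth_hom : coWirth.hom =
    conjugateEquiv adj₀ ((ihom.adjunction (dualizingObj H)).comp adj₂) urWirth.hom
  /-- The left projection formula `x ⊗ f_{(1)} y ≅ f_{(1)} (f^* x ⊗ y)`. -/
  leftProj : curriedTensor D ⋙ (whiskeringLeft C D D).obj L ≅
    F ⋙ curriedTensor C ⋙ (whiskeringRight C C D).obj L
  leftProj_hom (x : D) (y : C) : x ◁ urWirth.hom.app y ≫ (leftProj.hom.app x).app y =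
    (π.hom.app x).app (dualizingObj H ⊗ y) ≫
      G.map (swapIso (F.obj x) (dualizingObj H) y).hom ≫ urWirth.hom.app (F.obj x ⊗ y)
  /-- `f^* [x, y] ≅ [f^* x, f^* y]`. -/
  closed : internalHom ⋙ (whiskeringRight D D C).obj F ≅
    F.op ⋙ internalHom ⋙ (whiskeringLeft D C C).obj F
  closed_hom (x : D) : closed.hom.app (op x) =
    conjugateEquiv (adj₀.comp (ihom.adjunction x))
      ((ihom.adjunction (F.obj x)).comp adj₀) (leftProj.inv.app x)
  /-- `[f_{(1)} x, y] ≅ f_* [x, f^* y]`. -/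
  coLeftProj : L.op ⋙ internalHom ≅
    internalHom ⋙ (whiskeringLeft D C C).obj F ⋙ (whiskeringRight D C D).obj G
  coLeftProj_hom (x : C) : coLeftProj.hom.app (op x) =
    conjugateEquiv (tensorRightAdj (L.obj x))
      ((adj₁.comp (tensorRightAdj x)).comp adj₀) (leftProj.inv.flipApp x)
  /-- `f_{(1)} (f^* x ⊗ y) ≅ f_* (f^{(1)} x ⊗ y)`. -/
  mixed : F ⋙ curriedTensor C ⋙ (whiskeringRight C C D).obj L ≅
    H ⋙ curriedTensor C ⋙ (whiskeringRight C C D).obj G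
  mixed_hom (x : D) (y : C) : (mixed.hom.app x).app y =
    urWirth.inv.app (F.obj x ⊗ y) ≫ G.map (α_ (dualizingObj H) (F.obj x) y).inv ≫
      G.map (groth.hom.app x ▷ y)
  /-- `[f^* x, f^* y] ≅ [f^{(1)} x, f^{(1)} y]`. -/
  mixedHom : F.op ⋙ internalHom ⋙ (whiskeringLeft D C C).obj F ≅
    H.op ⋙ internalHom ⋙ (whiskeringLeft D C C).obj H
  mixedHom_hom (x : D) : mixedHom.hom.app (op x) =
    conjugateEquiv ((ihom.adjunction (F.obj x)).comp adj₀)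
      ((ihom.adjunction (H.obj x)).comp adj₂) (mixed.inv.app x)
  /-- `f_* [x, f^* y] ≅ f_{(-1)} [x, f^{(1)} y]`. -/
  mixedPush : internalHom ⋙ (whiskeringLeft D C C).obj F ⋙ (whiskeringRight D C D).obj G ≅
    internalHom ⋙ (whiskeringLeft D C C).obj H ⋙ (whiskeringRight D C D).obj K
  mixedPush_hom (x : C) : mixedPush.hom.app (op x) =
    conjugateEquiv ((adj₁.comp (tensorRightAdj x)).comp adj₀)
      ((adj₃.comp (tensorRightAdj x)).comp adj₂) (mixed.inv.flipApp x)
  /-- `f^* ≅ [ω, ω ⊗ f^* -]`. -/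
  coWirthGroth : F ≅ F ⋙ tensorLeft (dualizingObj H) ⋙ ihom (dualizingObj H)
  coWirthGroth_hom (y : D) : coWirthGroth.hom.app y =
    coWirth.hom.app y ≫ (ihom (dualizingObj H)).map (groth.inv.app y)
  /-- `𝟙 ≅ [ω, ω]`. -/
  unitIso : 𝟙_ C ≅ (ihom (dualizingObj H)).obj (dualizingObj H)
  unitIso_hom : unitIso.hom = Functor.LaxMonoidal.ε F ≫ coWirth.hom.app (𝟙_ D)

end Functors

end GNDuality

end

/-!
Brown representability provides right adjoints of coproduct-preserving exact functors: a
cohomological functor is represented by the homotopy colimit of a sequence of approximations. It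
gives `f_*`, and also `f^{(1)}`: since `f^*` preserves rigid, that is compact, objects, `f_*`
preserves coproducts.

A transformation of coproduct-preserving exact functors is invertible as soon as it is invertible on
compact objects. On rigid objects both the projection maps and the maps
`f^{(1)} x ⊗ f^* y ⟶ f^{(1)} (x ⊗ y)` are invertible by duality; this proves the projection formula
and, if `f^{(1)}` preserves coproducts, Grothendieck duality.

Suppose that `f^*` preserves products and let `c` be compact. By the projection formula
`Hom(𝟙, - ⊗ f_* c) ≅ Hom(𝟙, f_* (c ⊗ f^* -))`, and this functor preserves products as well as
coproducts. An exact functor to abelian groups with this property is corepresented by a compact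
object: preservation of coproducts makes it the colimit of its values on the compact objects over
the argument, and the product of all elements of these values is a weakly universal element, which
comes from a compact object; splitting an idempotent makes it universal. The corepresenting object
is a dual of `f_* c`, so `f_* c` is compact.

Conversely, suppose that `f_*` preserves compact objects. For a compact object `c` with dual `c'`,
the object `f_* c'` is rigid with dual `f_* (ω ⊗ c)`, and the projection formula then identifies
`Hom(c, f^* y)` with `Hom(f_* (ω ⊗ c), y) ≅ Hom(c, [ω, f^{(1)} y])`. Hence `f^* ≅ [ω, f^{(1)} -]`,
which has the left adjoint `f_* (ω ⊗ -)`. All other isomorphisms are conjugates or composites of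
these.
-/

noncomputable section

namespace GNDuality

section Coproducts

lemma exists_eq_sum_of_mem_iSup_range {J B : Type*} [AddCommGroup B] {A : J → Type*}
    [∀ j, AddCommGroup (A j)] (f : ∀ j, A j →+ B) {b : B} (hb : b ∈ ⨆ j, (f j).range) :
    ∃ (s : Finset J) (a : ∀ j, A j), b = ∑ j ∈ s, f j (a j) := by
  classical
  have hle : ⨆ j, (f j).range ≤ (DFinsupp.sumAddHom f).range := iSup_le fun j ↦ by
    rintro _ ⟨a, rfl⟩
    exact ⟨DFinsupp.single j a, DFinsupp.sumAddHom_single f j a⟩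
  obtain ⟨a, rfl⟩ := hle hb
  exact ⟨a.support, a, DFinsupp.sumAddHom_apply f a⟩

variable {T : Type u} [Category.{v} T]

/-- A functor to abelian groups is sum-generated if every element of its value at a coproduct is
a finite sum of elements coming from the summands. For additive functors this is a criterion for
the preservation of coproducts that can be checked element by element. -/
def IsSumGenerated (M : T ⥤ AddCommGrpCat.{v}) : Prop :=
  ∀ (J : Type v) (X : J → T) [HasCoproduct X], ⨆ j, (M.map (Sigma.ι X j)).hom.range = ⊤

lemma IsSumGenerated.exists_eq_sum {M : T ⥤ AddCommGrpCat.{v}} (hM : IsSumGenerated M) {J : Type v}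
    (X : J → T) [HasCoproduct X] (m : M.obj (∐ X)) :
    ∃ (s : Finset J) (a : ∀ j, M.obj (X j)), m = ∑ j ∈ s, M.map (Sigma.ι X j) (a j) :=
  exists_eq_sum_of_mem_iSup_range (fun j ↦ (M.map (Sigma.ι X j)).hom) (by simp [hM J X])

lemma isSumGenerated_of_preservesCoproducts (M : T ⥤ AddCommGrpCat.{v})
    (hM : PreservesCoproducts M) : IsSumGenerated M := by
  intro J X _
  set K := ⨆ j, (M.map (Sigma.ι X j)).hom.range
  have := hM J
  let q : M.obj (∐ X) ⟶ AddCommGrpCat.of (M.obj (∐ X) ⧸ K) :=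
    AddCommGrpCat.ofHom (QuotientAddGroup.mk' K)
  have hq : q = 0 := by
    refine (isColimitOfPreserves M (coproductIsCoproduct X)).hom_ext fun ⟨j⟩ ↦ ?_
    ext a
    exact (QuotientAddGroup.eq_zero_iff _).2
      (le_iSup (fun j ↦ (M.map (Sigma.ι X j)).hom.range) j ⟨a, rfl⟩)
  exact (AddSubgroup.eq_top_iff' _).2 fun m ↦ (QuotientAddGroup.eq_zero_iff m).1 congr($hq m)

variable [Preadditive T]

lemma map_sigmaπ_sum_map_sigmaι (M : T ⥤ AddCommGrpCat.{v}) [M.PreservesZeroMorphisms]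
    {J : Type v} [DecidableEq J] (X : J → T) [HasCoproduct X] (s : Finset J)
    (a : ∀ j, M.obj (X j)) {j : J} (hj : j ∈ s) :
    M.map (Sigma.π X j) (∑ k ∈ s, M.map (Sigma.ι X k) (a k)) = a j := by
  rw [map_sum, Finset.sum_eq_single j]
  · rw [← ConcreteCategory.comp_apply, ← M.map_comp, Sigma.ι_π_eq_id]
    simp
  · intro k _ hk
    rw [← ConcreteCategory.comp_apply, ← M.map_comp, Sigma.ι_π_of_ne _ hk]
    simp
  · exact fun h ↦ (h hj).elim

lemma bijective_sigmaComparison (M : T ⥤ AddCommGrpCat.{v}) [M.PreservesZeroMorphisms]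
    (hM : IsSumGenerated M) {J : Type v} (X : J → T) [HasCoproduct X] :
    Function.Bijective (sigmaComparison M X) := by
  classical
  have hι (j : J) (a) : sigmaComparison M X (Sigma.ι (fun j ↦ M.obj (X j)) j a) =
      M.map (Sigma.ι X j) a := by
    rw [← ConcreteCategory.comp_apply, ι_comp_sigmaComparison]
  constructor
  · rw [injective_iff_map_eq_zero]
    intro x hx
    obtain ⟨s, a, rfl⟩ := (isSumGenerated_of_preservesCoproducts (𝟭 AddCommGrpCat.{v})
      (fun _ ↦ inferInstance)).exists_eq_sum (fun j ↦ M.obj (X j)) x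
    refine Finset.sum_eq_zero fun j hj ↦ ?_
    simp only [map_sum, Functor.id_map, hι] at hx
    have ha : a j = 0 := by rw [← map_sigmaπ_sum_map_sigmaι M X s a hj, hx, map_zero]
    simp [ha]
  · intro y
    obtain ⟨s, a, rfl⟩ := hM.exists_eq_sum X y
    exact ⟨∑ j ∈ s, Sigma.ι (fun j ↦ M.obj (X j)) j (a j), by simp [hι]⟩

lemma preservesCoproducts_of_isSumGenerated [HasCoproducts.{v} T] (M : T ⥤ AddCommGrpCat.{v})
    [M.PreservesZeroMorphisms] (hM : IsSumGenerated M) : PreservesCoproducts M := fun J ↦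
  have (X : J → T) : PreservesColimit (Discrete.functor X) M := by
    have := (ConcreteCategory.isIso_iff_bijective _).2 (bijective_sigmaComparison M hM X)
    exact PreservesCoproduct.of_iso_comparison M X
  preservesColimitsOfShape_of_discrete M

end Coproducts

section CompactObjects

variable {T : Type u} [Category.{v} T] [Preadditive T]

lemma IsCompactObj.exists_eq_sum {t : T} (ht : IsCompactObj t) {J : Type v} (X : J → T)
    [HasCoproduct X] (f : t ⟶ ∐ X) :
    ∃ (s : Finset J) (g : ∀ j, t ⟶ X j), f = ∑ j ∈ s, g j ≫ Sigma.ι X j :=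
  (isSumGenerated_of_preservesCoproducts _ ht).exists_eq_sum X f

lemma sum_comp_sigmaι_π {t : T} {J : Type v} [DecidableEq J] (X : J → T) [HasCoproduct X]
    (s : Finset J) (g : ∀ j, t ⟶ X j) {j : J} (hj : j ∈ s) :
    (∑ k ∈ s, g k ≫ Sigma.ι X k) ≫ Sigma.π X j = g j :=
  map_sigmaπ_sum_map_sigmaι (preadditiveCoyoneda.obj (op t)) X s g hj

lemma isCompactObj_of_mem_iSup [HasCoproducts.{v} T] {t : T}
    (h : ∀ (J : Type v) (X : J → T) (f : t ⟶ ∐ X),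
      f ∈ ⨆ j, (Preadditive.rightComp t (Sigma.ι X j)).range) : IsCompactObj t :=
  preservesCoproducts_of_isSumGenerated _ fun J X _ ↦ (AddSubgroup.eq_top_iff' _).2 (h J X)

lemma sum_comp_sigmaι_mem_iSup {t : T} {J : Type v} (X : J → T) [HasCoproduct X] (s : Finset J)
    (g : ∀ j, t ⟶ X j) :
    ∑ j ∈ s, g j ≫ Sigma.ι X j ∈ ⨆ j, (Preadditive.rightComp t (Sigma.ι X j)).range :=
  sum_mem fun j _ ↦ le_iSup (fun j ↦ (Preadditive.rightComp t (Sigma.ι X j)).range) j ⟨g j, rfl⟩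

lemma IsCompactObj.of_iso {t t' : T} (ht : IsCompactObj t) (e : t ≅ t') : IsCompactObj t' := fun J ↦
  have := ht J
  preservesColimitsOfShape_of_natIso (preadditiveCoyoneda.mapIso e.symm.op)

lemma IsCompactObj.of_retract [HasCoproducts.{v} T] {t t' : T} (ht : IsCompactObj t)
    (i : t' ⟶ t) (r : t ⟶ t') (h : i ≫ r = 𝟙 t') : IsCompactObj t' :=
  isCompactObj_of_mem_iSup fun J X f ↦ by
    obtain ⟨s, g, hg⟩ := ht.exists_eq_sum X (r ≫ f)
    have hf : f = ∑ j ∈ s, (i ≫ g j) ≫ Sigma.ι X j := by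
      rw [← Category.id_comp f, ← h, Category.assoc, hg, Preadditive.comp_sum]
      simp only [Category.assoc]
    exact hf ▸ sum_comp_sigmaι_mem_iSup X s _

variable {S : Type u₁} [Category.{v} S] [Preadditive S]

/-- The adjunction isomorphism `Hom(A t, -) ≅ Hom(t, B -)` of functors to abelian groups. -/
def preadditiveCoyonedaObjIso {A : S ⥤ T} {B : T ⥤ S} [A.Additive] (adj : A ⊣ B) (t : S) :
    preadditiveCoyoneda.obj (op (A.obj t)) ≅ B ⋙ preadditiveCoyoneda.obj (op t) :=
  NatIso.ofComponents (fun X ↦ (adj.homAddEquiv t X).toAddCommGrpIso) fun f ↦ by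
    ext g
    exact adj.homEquiv_naturality_right g f

lemma IsCompactObj.of_adjunction {A : S ⥤ T} {B : T ⥤ S} [A.Additive] (adj : A ⊣ B)
    (hB : PreservesCoproducts B) {t : S} (ht : IsCompactObj t) : IsCompactObj (A.obj t) := fun J ↦
  have := hB J
  have := ht J
  preservesColimitsOfShape_of_natIso (preadditiveCoyonedaObjIso adj t).symm

lemma IsCompactObj.shift [HasShift T ℤ] [∀ n : ℤ, (shiftFunctor T n).Additive] {t : T}
    (ht : IsCompactObj t) (n : ℤ) : IsCompactObj (t⟦n⟧) :=
  ht.of_adjunction (A := shiftFunctor T n) (shiftEquiv T n).toAdjunction fun _ ↦ inferInstance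

open Pretriangulated

variable [HasZeroObject T] [HasShift T ℤ] [∀ n : ℤ, (shiftFunctor T n).Additive] [Pretriangulated T]

lemma IsCompactObj.exists_sum_sub_mem_ker_of_distTriang {S : Triangle T} (hS : S ∈ distTriang T)
    (h₂ : IsCompactObj S.obj₂) {J : Type v} (X : J → T) [HasCoproduct X] (f : S.obj₃ ⟶ ∐ X) :
    ∃ (s : Finset J) (g : ∀ j, S.obj₃ ⟶ X j), S.mor₂ ≫ (f - ∑ j ∈ s, g j ≫ Sigma.ι X j) = 0 := by
  classical
  obtain ⟨s, g, hg⟩ := h₂.exists_eq_sum X (S.mor₂ ≫ f)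
  have hg₀ (j : J) (hj : j ∈ s) : S.mor₁ ≫ g j = 0 := by
    rw [← sum_comp_sigmaι_π X s g hj, ← hg, Category.assoc,
      comp_distTriang_mor_zero₁₂_assoc _ hS, zero_comp]
  have hext (j : J) : ∃ h : S.obj₃ ⟶ X j, j ∈ s → g j = S.mor₂ ≫ h := by
    by_cases hj : j ∈ s
    · obtain ⟨h, hh⟩ := S.yoneda_exact₂ hS (g j) (hg₀ j hj)
      exact ⟨h, fun _ ↦ hh⟩
    · exact ⟨0, fun h ↦ (hj h).elim⟩
  choose h hh using hext
  refine ⟨s, h, ?_⟩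
  rw [Preadditive.comp_sub, hg, Preadditive.comp_sum, sub_eq_zero]
  exact Finset.sum_congr rfl fun j hj ↦ by rw [hh j hj, Category.assoc]

lemma IsCompactObj.cone [HasCoproducts.{v} T] {S : Triangle T} (hS : S ∈ distTriang T)
    (h₁ : IsCompactObj S.obj₁) (h₂ : IsCompactObj S.obj₂) : IsCompactObj S.obj₃ :=
  isCompactObj_of_mem_iSup fun J X f ↦ by
    obtain ⟨s, g, hg⟩ := h₂.exists_sum_sub_mem_ker_of_distTriang hS X f
    obtain ⟨k, hk⟩ := S.yoneda_exact₃ hS _ hg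
    obtain ⟨s', g', rfl⟩ := (h₁.shift 1).exists_eq_sum X k
    have hf : f = ∑ j ∈ s, g j ≫ Sigma.ι X j + ∑ j ∈ s', (S.mor₃ ≫ g' j) ≫ Sigma.ι X j := by
      simp only [Category.assoc, ← Preadditive.comp_sum, ← hk, add_sub_cancel]
    rw [hf]
    exact add_mem (sum_comp_sigmaι_mem_iSup X s g) (sum_comp_sigmaι_mem_iSup X s' _)

end CompactObjects

section Shift

variable {T : Type u} [Category.{v} T] [Preadditive T] [HasShift T ℤ]
  [∀ n : ℤ, (shiftFunctor T n).Additive]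

lemma eq_zero_of_comp_shift_map_eq_zero {t Y Z : T} {f : Y ⟶ Z}
    (hf : ∀ w : t⟦(-1 : ℤ)⟧ ⟶ Y, w ≫ f = 0 → w = 0) {d : t ⟶ Y⟦(1 : ℤ)⟧}
    (hd : d ≫ f⟦(1 : ℤ)⟧' = 0) : d = 0 := by
  let adj : shiftFunctor T (-1 : ℤ) ⊣ shiftFunctor T (1 : ℤ) :=
    (shiftEquiv T (1 : ℤ)).symm.toAdjunction
  have hw : (adj.homEquiv t Y).symm d = 0 := hf _ <| by
    rw [← adj.homEquiv_naturality_right_symm, hd, adj.homAddEquiv_symm_zero]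
  rw [← (adj.homEquiv t Y).apply_symm_apply d, hw, adj.homAddEquiv_zero]

end Shift

section HomotopyColimits

variable {T : Type u} [Category.{v} T] [HasCoproducts.{v} T]

/-- The coproduct of a sequence of objects; the index type is lifted to the universe in which
coproducts are assumed to exist. -/
abbrev seqCoproduct (X : ℕ → T) : T := ∐ fun n : ULift.{v} ℕ ↦ X n.down

/-- The inclusion of a term of a sequence into the coproduct of the sequence. -/
abbrev seqι (X : ℕ → T) (n : ℕ) : X n ⟶ seqCoproduct X :=
  Sigma.ι (fun n : ULift.{v} ℕ ↦ X n.down) ⟨n⟩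

lemma seqCoproduct_hom_ext {X : ℕ → T} {Z : T} {f g : seqCoproduct X ⟶ Z}
    (h : ∀ n, seqι X n ≫ f = seqι X n ≫ g) : f = g :=
  Sigma.hom_ext _ _ fun n ↦ h n.down

variable [Preadditive T]

/-- The projection of the coproduct of a sequence onto one of its terms. -/
abbrev seqπ (X : ℕ → T) (n : ℕ) : seqCoproduct X ⟶ X n :=
  Sigma.π (fun n : ULift.{v} ℕ ↦ X n.down) ⟨n⟩

/-- The map `1 - shift` on the coproduct of a sequence; its cone is the homotopy colimit of the
sequence. -/
def oneSubShift (X : ℕ → T) (φ : ∀ n, X n ⟶ X (n + 1)) : seqCoproduct X ⟶ seqCoproduct X :=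
  Sigma.desc fun n ↦ seqι X n.down - φ n.down ≫ seqι X (n.down + 1)

variable (X : ℕ → T) (φ : ∀ n, X n ⟶ X (n + 1))

lemma seqι_oneSubShift (n : ℕ) :
    seqι X n ≫ oneSubShift X φ = seqι X n - φ n ≫ seqι X (n + 1) := by
  simp [oneSubShift, seqι]

lemma seqι_oneSubShift_comp {Z : T} (f : seqCoproduct X ⟶ Z) (n : ℕ) :
    seqι X n ≫ oneSubShift X φ ≫ f = seqι X n ≫ f - φ n ≫ seqι X (n + 1) ≫ f := by
  rw [← Category.assoc, seqι_oneSubShift, Preadditive.sub_comp, Category.assoc]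

lemma seqι_π_self (n : ℕ) : seqι X n ≫ seqπ X n = 𝟙 _ := by
  classical exact Sigma.ι_π_eq_id _ _

lemma seqι_π_of_ne {n m : ℕ} (h : n ≠ m) : seqι X n ≫ seqπ X m = 0 := by
  classical exact Sigma.ι_π_of_ne _ (by simpa using h)

lemma oneSubShift_π_zero : oneSubShift X φ ≫ seqπ X 0 = seqπ X 0 :=
  seqCoproduct_hom_ext fun n ↦ by
    rw [seqι_oneSubShift_comp, seqι_π_of_ne X n.succ_ne_zero, comp_zero, sub_zero]

lemma oneSubShift_π_succ (m : ℕ) :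
    oneSubShift X φ ≫ seqπ X (m + 1) = seqπ X (m + 1) - seqπ X m ≫ φ m :=
  seqCoproduct_hom_ext fun n ↦ by
    rw [seqι_oneSubShift_comp, Preadditive.comp_sub]
    congr 1
    obtain rfl | h := eq_or_ne n m
    · rw [seqι_π_self, ← Category.assoc, seqι_π_self, Category.id_comp, Category.comp_id]
    · rw [seqι_π_of_ne X (by simpa using h), ← Category.assoc, seqι_π_of_ne X h, comp_zero,
        zero_comp]

lemma eq_zero_of_comp_oneSubShift {t : T} (ht : IsCompactObj t) (f : t ⟶ seqCoproduct X)
    (hf : f ≫ oneSubShift X φ = 0) : f = 0 := by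
  classical
  have hπ (n : ℕ) : f ≫ seqπ X n = 0 := by
    induction n with
    | zero => rw [← oneSubShift_π_zero X φ, reassoc_of% hf, zero_comp]
    | succ n hn =>
      rw [← sub_add_cancel (seqπ X (n + 1)) (seqπ X n ≫ φ n), ← oneSubShift_π_succ,
        Preadditive.comp_add, reassoc_of% hf, reassoc_of% hn, zero_comp, zero_comp, add_zero]
  obtain ⟨s, g, rfl⟩ := ht.exists_eq_sum _ f
  refine Finset.sum_eq_zero fun j hj ↦ ?_
  rw [← sum_comp_sigmaι_π _ s g hj, hπ j.down, zero_comp]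

open Pretriangulated

variable [HasZeroObject T] [HasShift T ℤ] [∀ n : ℤ, (shiftFunctor T n).Additive] [Pretriangulated T]

variable {Z : T} {p : seqCoproduct X ⟶ Z} {d : Z ⟶ (seqCoproduct X)⟦(1 : ℤ)⟧}

lemma seqι_comp_eq (hZ : Triangle.mk (oneSubShift X φ) p d ∈ distTriang T) (n : ℕ) :
    seqι X n ≫ p = φ n ≫ seqι X (n + 1) ≫ p := by
  have h : oneSubShift X φ ≫ p = 0 := comp_distTriang_mor_zero₁₂ _ hZ
  rw [← sub_eq_zero, ← seqι_oneSubShift_comp, h, comp_zero]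

lemma exists_comp_seqι_of_le (hZ : Triangle.mk (oneSubShift X φ) p d ∈ distTriang T) {t : T}
    {n m : ℕ} (hnm : n ≤ m) (g : t ⟶ X n) :
    ∃ g' : t ⟶ X m, g ≫ seqι X n ≫ p = g' ≫ seqι X m ≫ p := by
  induction m, hnm using Nat.le_induction with
  | base => exact ⟨g, rfl⟩
  | succ m _ h =>
    obtain ⟨g', hg'⟩ := h
    exact ⟨g' ≫ φ m, by rw [hg', seqι_comp_eq X φ hZ m, Category.assoc]⟩

lemma IsCompactObj.exists_factor_seqι (hZ : Triangle.mk (oneSubShift X φ) p d ∈ distTriang T)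
    {t : T} (ht : IsCompactObj t) (f : t ⟶ Z) :
    ∃ (n : ℕ) (g : t ⟶ X n), f = g ≫ seqι X n ≫ p := by
  have hd : f ≫ d = 0 := by
    have h₃₁ : d ≫ (oneSubShift X φ)⟦(1 : ℤ)⟧' = 0 := comp_distTriang_mor_zero₃₁ _ hZ
    exact eq_zero_of_comp_shift_map_eq_zero (eq_zero_of_comp_oneSubShift X φ (ht.shift (-1)))
      (by rw [Category.assoc, h₃₁, comp_zero])
  obtain ⟨h, rfl⟩ : ∃ h : t ⟶ seqCoproduct X, f = h ≫ p := Triangle.coyoneda_exact₃ _ hZ f hd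
  obtain ⟨s, g, rfl⟩ := ht.exists_eq_sum _ h
  clear hd
  rw [Preadditive.sum_comp]
  induction s using Finset.cons_induction with
  | empty => exact ⟨0, 0, by simp⟩
  | cons j s hj ih =>
    obtain ⟨n, g', hg'⟩ := ih
    obtain ⟨a, ha⟩ := exists_comp_seqι_of_le X φ hZ (le_max_left n j.down) g'
    obtain ⟨b, hb⟩ := exists_comp_seqι_of_le X φ hZ (le_max_right n j.down) (g j)
    exact ⟨_, b + a, by
      rw [Finset.sum_cons, hg', ha, Preadditive.add_comp, ← hb, Category.assoc]⟩

end HomotopyColimits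

section BrownFunctors

open Pretriangulated

variable {T : Type u} [Category.{v} T] [HasZeroObject T] [Preadditive T] [HasShift T ℤ]
  [∀ n : ℤ, (shiftFunctor T n).Additive] [Pretriangulated T]

/-- An additive cohomological functor that sends coproducts to products: the functors to which
Brown representability applies. -/
structure IsBrownFunctor (H : Tᵒᵖ ⥤ AddCommGrpCat.{v}) : Prop where
  additive : H.Additive
  exact {S : Triangle T} (hS : S ∈ distTriang T) :
    Function.Exact (H.map S.mor₂.op) (H.map S.mor₁.op)
  bijective {J : Type v} (X : J → T) [HasCoproduct X] :
    Function.Bijective fun (x : H.obj (op (∐ X))) j ↦ H.map (Sigma.ι X j).op x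

/-- A class of objects closed under isomorphisms, cones and coproducts. In a compactly generated
category it contains everything as soon as it contains the compact objects. -/
structure IsLocalizing (P : ObjectProperty T) : Prop where
  of_iso {X Y : T} (e : X ≅ Y) (hX : P X) : P Y
  cone {S : Triangle T} (hS : S ∈ distTriang T) (h₁ : P S.obj₁) (h₂ : P S.obj₂) : P S.obj₃
  coproduct {J : Type v} (X : J → T) [HasCoproduct X] (hX : ∀ j, P (X j)) : P (∐ X)

lemma isBrownFunctor_preadditiveYoneda (t : T) : IsBrownFunctor (preadditiveYoneda.obj t) where
  additive := inferInstance
  exact {S} hS f := by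
    refine ⟨fun hf ↦ ?_, ?_⟩
    · obtain ⟨g, hg⟩ := S.yoneda_exact₂ hS f hf
      exact ⟨g, hg.symm⟩
    · rintro ⟨g, rfl⟩
      exact (comp_distTriang_mor_zero₁₂_assoc S hS g).trans zero_comp
  bijective X _ :=
    ⟨fun f g hfg ↦ Sigma.hom_ext f g (congr_fun hfg),
      fun g ↦ ⟨Sigma.desc g, funext fun j ↦ Sigma.ι_desc g j⟩⟩

namespace IsBrownFunctor

variable {H : Tᵒᵖ ⥤ AddCommGrpCat.{v}}

lemma eq_zero (hH : IsBrownFunctor H) {J : Type v} (X : J → T) [HasCoproduct X]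
    (x : H.obj (op (∐ X))) (hx : ∀ j, H.map (Sigma.ι X j).op x = 0) : x = 0 :=
  (hH.bijective X).1 (funext fun j ↦ (hx j).trans (map_zero _).symm)

lemma exists_of (hH : IsBrownFunctor H) {J : Type v} (X : J → T) [HasCoproduct X]
    (x : ∀ j, H.obj (op (X j))) : ∃ y : H.obj (op (∐ X)), ∀ j, H.map (Sigma.ι X j).op y = x j := by
  obtain ⟨y, hy⟩ := (hH.bijective X).2 x
  exact ⟨y, congr_fun hy⟩

lemma exists_of_seq [HasCoproducts.{v} T] (hH : IsBrownFunctor H)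
    (X : ℕ → T) (φ : ∀ n, X n ⟶ X (n + 1)) {Z : T} {p : seqCoproduct X ⟶ Z}
    {d : Z ⟶ (seqCoproduct X)⟦(1 : ℤ)⟧}
    (hZ : Triangle.mk (oneSubShift X φ) p d ∈ distTriang T) (x : ∀ n, H.obj (op (X n)))
    (hx : ∀ n, H.map (φ n).op (x (n + 1)) = x n) :
    ∃ z : H.obj (op Z), ∀ n, H.map (seqι X n ≫ p).op z = x n := by
  have := hH.additive
  obtain ⟨y, hy⟩ := hH.exists_of (fun n : ULift.{v} ℕ ↦ X n.down) (fun n ↦ x n.down)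
  replace hy (n : ℕ) : H.map (seqι X n).op y = x n := hy ⟨n⟩
  have hy₀ : H.map (oneSubShift X φ).op y = 0 := hH.eq_zero _ _ fun ⟨n⟩ ↦ by
    change H.map (seqι X n).op (H.map (oneSubShift X φ).op y) = 0
    rw [← ConcreteCategory.comp_apply, ← H.map_comp, ← op_comp, seqι_oneSubShift, op_sub,
      H.map_sub]
    change H.map (seqι X n).op y - H.map (φ n ≫ seqι X (n + 1)).op y = 0
    rw [op_comp, H.map_comp, ConcreteCategory.comp_apply, hy, hy, hx, sub_self]
  obtain ⟨z, hz⟩ : ∃ z : H.obj (op Z), H.map p.op z = y := (hH.exact hZ y).1 hy₀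
  refine ⟨z, fun n ↦ ?_⟩
  rw [op_comp, H.map_comp, ConcreteCategory.comp_apply, hz, hy]

variable [HasCoproducts.{v} T] {ι : Type v} (S : ι → T) {P : ObjectProperty T}

lemma exists_hom_annihilating (hH : IsBrownFunctor H) (hP : IsLocalizing P) (hS : ∀ i, P (S i))
    {X : T} (hX : P X) (x : H.obj (op X)) :
    ∃ (Y : T) (y : H.obj (op Y)) (φ : X ⟶ Y), P Y ∧ H.map φ.op y = x ∧
      ∀ (i : ι) (f : S i ⟶ X), H.map f.op x = 0 → f ≫ φ = 0 := by
  let J := Σ i : ι, { f : S i ⟶ X // H.map f.op x = 0 }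
  let U : J → T := fun j ↦ S j.1
  let a : ∐ U ⟶ X := Sigma.desc fun j ↦ j.2.1
  obtain ⟨Y, φ, d, hY⟩ := distinguished_cocone_triangle a
  have hx : H.map a.op x = 0 := hH.eq_zero _ _ fun j ↦ by
    rw [← ConcreteCategory.comp_apply, ← H.map_comp, ← op_comp, Sigma.ι_desc]
    exact j.2.2
  obtain ⟨y, hy⟩ : ∃ y : H.obj (op Y), H.map φ.op y = x := (hH.exact hY x).1 hx
  refine ⟨Y, y, φ, hP.cone hY (hP.coproduct U fun j ↦ hS j.1) hX, hy, fun i f hf ↦ ?_⟩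
  have hfa : f = Sigma.ι U ⟨i, f, hf⟩ ≫ a := by simp [a]
  have haφ : a ≫ φ = 0 := comp_distTriang_mor_zero₁₂ _ hY
  rw [hfa, Category.assoc, haφ, comp_zero]

lemma exists_seq_annihilating (hH : IsBrownFunctor H) (hP : IsLocalizing P) (hS : ∀ i, P (S i))
    {X₀ : T} (hX₀ : P X₀) (x₀ : H.obj (op X₀)) :
    ∃ (X : ℕ → T) (x : ∀ n, H.obj (op (X n))) (φ : ∀ n, X n ⟶ X (n + 1)) (φ₀ : X₀ ⟶ X 0),
      (∀ n, P (X n)) ∧ H.map φ₀.op (x 0) = x₀ ∧ (∀ n, H.map (φ n).op (x (n + 1)) = x n) ∧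
        ∀ (n : ℕ) (i : ι) (f : S i ⟶ X n), H.map f.op (x n) = 0 → f ≫ φ n = 0 := by
  let A := Σ X : { X : T // P X }, H.obj (op X.1)
  have step (a : A) : ∃ (b : A) (φ : a.1.1 ⟶ b.1.1), H.map φ.op b.2 = a.2 ∧
      ∀ (i : ι) (f : S i ⟶ a.1.1), H.map f.op a.2 = 0 → f ≫ φ = 0 := by
    obtain ⟨Y, y, φ, hY, h⟩ := hH.exists_hom_annihilating S hP hS a.1.2 a.2
    exact ⟨⟨⟨Y, hY⟩, y⟩, φ, h⟩
  choose next φ hφ hφ' using step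
  let a (n : ℕ) : A := Nat.rec ⟨⟨X₀, hX₀⟩, x₀⟩ (fun _ ↦ next) n
  exact ⟨fun n ↦ (a n).1.1, fun n ↦ (a n).2, fun n ↦ φ (a n), 𝟙 _, fun n ↦ (a n).1.2,
    by simp [a], fun n ↦ hφ (a n), fun n ↦ hφ' (a n)⟩

/-- The homotopy colimit of a sequence in which each map kills the morphisms from the `S i` that
`H` does not see represents `H` on the `S i`. -/
lemma exists_bijective_of_isCompactObj (hH : IsBrownFunctor H) (hP : IsLocalizing P)
    (hS : ∀ i, P (S i)) (hSc : ∀ i, IsCompactObj (S i)) :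
    ∃ (Z : T) (z : H.obj (op Z)), P Z ∧
      ∀ i, Function.Bijective fun f : S i ⟶ Z ↦ H.map f.op z := by
  have := hH.additive
  let U : (Σ i : ι, H.obj (op (S i))) → T := fun j ↦ S j.1
  obtain ⟨x₀, hx₀⟩ := hH.exists_of U fun j ↦ j.2
  obtain ⟨X, x, φ, φ₀, hX, hφ₀, hφ, hφ'⟩ :=
    hH.exists_seq_annihilating S hP hS (hP.coproduct U fun j ↦ hS j.1) x₀
  obtain ⟨Z, p, d, hZ⟩ := distinguished_cocone_triangle (oneSubShift X φ)
  obtain ⟨z, hz⟩ := hH.exists_of_seq X φ hZ x hφ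
  have hPX : P (seqCoproduct X) := hP.coproduct _ fun n ↦ hX n.down
  refine ⟨Z, z, hP.cone hZ hPX hPX, fun i ↦ ⟨fun f f' hff' ↦ ?_, fun h ↦ ?_⟩⟩
  · obtain ⟨n, g, hg⟩ := (hSc i).exists_factor_seqι X φ hZ (f - f')
    have hgx : H.map g.op (x n) = 0 := by
      rw [← hz, ← ConcreteCategory.comp_apply, ← H.map_comp, ← op_comp, ← hg, op_sub, H.map_sub]
      exact sub_eq_zero.2 hff'
    rw [← sub_eq_zero, hg, seqι_comp_eq X φ hZ, ← Category.assoc, hφ' n i g hgx, zero_comp]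
  · refine ⟨Sigma.ι U ⟨i, h⟩ ≫ φ₀ ≫ seqι X 0 ≫ p, ?_⟩
    dsimp only
    rw [op_comp, op_comp, H.map_comp, H.map_comp, ConcreteCategory.comp_apply,
      ConcreteCategory.comp_apply, hz, hφ₀]
    exact hx₀ ⟨i, h⟩

end IsBrownFunctor

end BrownFunctors

section Induction

variable {T : Type u} [Category.{v} T]

lemma sigmaComparison_naturality {T' : Type u₁} [Category.{v} T'] {M M' : T ⥤ T'} (τ : M ⟶ M')
    {J : Type v} (X : J → T) [HasCoproduct X] [HasCoproduct fun j ↦ M.obj (X j)]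
    [HasCoproduct fun j ↦ M'.obj (X j)] :
    sigmaComparison M X ≫ τ.app (∐ X) =
      Limits.Sigma.map (fun j ↦ τ.app (X j)) ≫ sigmaComparison M' X :=
  Sigma.hom_ext _ _ fun j ↦ by simp

lemma isIso_app_sigma {T' : Type u₁} [Category.{v} T'] [HasCoproducts.{v} T'] {M M' : T ⥤ T'}
    (hM : PreservesCoproducts M) (hM' : PreservesCoproducts M') (τ : M ⟶ M') {J : Type v}
    (X : J → T) [HasCoproduct X] (hX : ∀ j, IsIso (τ.app (X j))) : IsIso (τ.app (∐ X)) := by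
  have := hM J
  have := hM' J
  have : IsIso (Limits.Sigma.map fun j ↦ τ.app (X j)) :=
    (Limits.Sigma.mapIso fun j ↦ asIso (τ.app (X j))).isIso_hom
  have : IsIso (sigmaComparison M X ≫ τ.app (∐ X)) := by
    rw [sigmaComparison_naturality]
    infer_instance
  exact IsIso.of_isIso_comp_left (sigmaComparison M X) _

lemma isIso_five {A₁ A₂ A₃ A₄ A₅ B₁ B₂ B₃ B₄ B₅ : AddCommGrpCat.{v}}
    {f₁ : A₁ ⟶ A₂} {f₂ : A₂ ⟶ A₃} {f₃ : A₃ ⟶ A₄} {f₄ : A₄ ⟶ A₅}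
    {g₁ : B₁ ⟶ B₂} {g₂ : B₂ ⟶ B₃} {g₃ : B₃ ⟶ B₄} {g₄ : B₄ ⟶ B₅}
    {i₁ : A₁ ⟶ B₁} {i₂ : A₂ ⟶ B₂} {i₃ : A₃ ⟶ B₃} {i₄ : A₄ ⟶ B₄} {i₅ : A₅ ⟶ B₅}
    (hc₁ : i₁ ≫ g₁ = f₁ ≫ i₂) (hc₂ : i₂ ≫ g₂ = f₂ ≫ i₃) (hc₃ : i₃ ≫ g₃ = f₃ ≫ i₄)
    (hc₄ : i₄ ≫ g₄ = f₄ ≫ i₅)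
    (hf₁ : Function.Exact f₁ f₂) (hf₂ : Function.Exact f₂ f₃) (hf₃ : Function.Exact f₃ f₄)
    (hg₁ : Function.Exact g₁ g₂) (hg₂ : Function.Exact g₂ g₃) (hg₃ : Function.Exact g₃ g₄)
    (h₁ : IsIso i₁) (h₂ : IsIso i₂) (h₄ : IsIso i₄) (h₅ : IsIso i₅) : IsIso i₃ := by
  rw [ConcreteCategory.isIso_iff_bijective] at *
  exact AddMonoidHom.bijective_of_surjective_of_bijective_of_bijective_of_injective
    f₁.hom f₂.hom f₃.hom f₄.hom g₁.hom g₂.hom g₃.hom g₄.hom i₁.hom i₂.hom i₃.hom i₄.hom i₅.hom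
    congr(($hc₁).hom) congr(($hc₂).hom) congr(($hc₃).hom) congr(($hc₄).hom)
    hf₁ hf₂ hf₃ hg₁ hg₂ hg₃ h₁.2 h₂ h₄ h₅.1

open Pretriangulated

variable [HasZeroObject T] [Preadditive T] [HasShift T ℤ]
  [∀ n : ℤ, (shiftFunctor T n).Additive] [Pretriangulated T]

lemma exact_map_of_distTriang (M : T ⥤ AddCommGrpCat.{v}) [M.IsHomological] {S : Triangle T}
    (hS : S ∈ distTriang T) : Function.Exact (M.map S.mor₁) (M.map S.mor₂) :=
  (ShortComplex.ab_exact_iff_function_exact _).1 (M.map_distinguished_exact S hS)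

lemma isIso_app_obj₃ {M M' : T ⥤ AddCommGrpCat.{v}} [M.IsHomological] [M'.IsHomological]
    (τ : M ⟶ M') {S : Triangle T} (hS : S ∈ distTriang T)
    (h₁ : ∀ n : ℤ, IsIso (τ.app (S.obj₁⟦n⟧))) (h₂ : ∀ n : ℤ, IsIso (τ.app (S.obj₂⟦n⟧))) :
    IsIso (τ.app S.obj₃) := by
  have hS' := rot_of_distTriang _ hS
  have hS'' := rot_of_distTriang _ hS'
  exact isIso_five (τ.naturality _).symm (τ.naturality _).symm (τ.naturality _).symm
    (τ.naturality _).symm (exact_map_of_distTriang M hS) (exact_map_of_distTriang M hS')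
    (exact_map_of_distTriang M hS'') (exact_map_of_distTriang M' hS)
    (exact_map_of_distTriang M' hS') (exact_map_of_distTriang M' hS'')
    ((NatTrans.isIso_app_iff_of_iso τ ((shiftFunctorZero T ℤ).app _)).1 (h₁ 0))
    ((NatTrans.isIso_app_iff_of_iso τ ((shiftFunctorZero T ℤ).app _)).1 (h₂ 0)) (h₁ 1) (h₂ 1)

lemma isLocalizing_isIso_app [HasCoproducts.{v} T] {M M' : T ⥤ AddCommGrpCat.{v}}
    [M.IsHomological] [M'.IsHomological] (hM : PreservesCoproducts M)
    (hM' : PreservesCoproducts M') (τ : M ⟶ M') :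
    IsLocalizing fun X : T ↦ ∀ n : ℤ, IsIso (τ.app (X⟦n⟧)) where
  of_iso e hX n := (NatTrans.isIso_app_iff_of_iso τ ((shiftFunctor T n).mapIso e)).1 (hX n)
  cone {S} hS h₁ h₂ n :=
    isIso_app_obj₃ τ (Triangle.shift_distinguished S hS n)
      (fun m ↦ (NatTrans.isIso_app_iff_of_iso τ ((shiftFunctorAdd T n m).app S.obj₁)).1 (h₁ _))
      (fun m ↦ (NatTrans.isIso_app_iff_of_iso τ ((shiftFunctorAdd T n m).app S.obj₂)).1 (h₂ _))
  coproduct X _ hX n :=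
    (NatTrans.isIso_app_iff_of_iso τ (PreservesCoproduct.iso (shiftFunctor T n) X)).2
      (isIso_app_sigma hM hM' τ _ fun j ↦ hX j n)

namespace IsBrownFunctor

variable {H H' : Tᵒᵖ ⥤ AddCommGrpCat.{v}}

lemma isIso_app_obj₃ (hH : IsBrownFunctor H) (hH' : IsBrownFunctor H') (τ : H ⟶ H')
    {S : Triangle T} (hS : S ∈ distTriang T) (h₁ : ∀ n : ℤ, IsIso (τ.app (op (S.obj₁⟦n⟧))))
    (h₂ : ∀ n : ℤ, IsIso (τ.app (op (S.obj₂⟦n⟧)))) : IsIso (τ.app (op S.obj₃)) := by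
  have hS' := rot_of_distTriang _ hS
  have hS'' := rot_of_distTriang _ hS'
  exact isIso_five (τ.naturality _).symm (τ.naturality _).symm (τ.naturality _).symm
    (τ.naturality _).symm (hH.exact hS'') (hH.exact hS') (hH.exact hS) (hH'.exact hS'')
    (hH'.exact hS') (hH'.exact hS) (h₂ 1) (h₁ 1)
    ((NatTrans.isIso_app_iff_of_iso τ ((shiftFunctorZero T ℤ).symm.app _).op).1 (h₂ 0))
    ((NatTrans.isIso_app_iff_of_iso τ ((shiftFunctorZero T ℤ).symm.app _).op).1 (h₁ 0))

lemma isIso_app_sigma (hH : IsBrownFunctor H) (hH' : IsBrownFunctor H') (τ : H ⟶ H') {J : Type v}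
    (X : J → T) [HasCoproduct X] (hX : ∀ j, IsIso (τ.app (op (X j)))) :
    IsIso (τ.app (op (∐ X))) := by
  simp only [ConcreteCategory.isIso_iff_bijective] at hX ⊢
  refine (Function.Bijective.of_comp_iff' (hH'.bijective X) _).1 ?_
  convert (Function.Bijective.piMap hX).comp (hH.bijective X) using 1
  ext x j
  exact (NatTrans.naturality_apply τ (Sigma.ι X j).op x).symm

lemma isLocalizing_isIso_app (hH : IsBrownFunctor H) (hH' : IsBrownFunctor H') (τ : H ⟶ H')
    [HasCoproducts.{v} T] : IsLocalizing fun X : T ↦ ∀ n : ℤ, IsIso (τ.app (op (X⟦n⟧))) where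
  of_iso e hX n :=
    (NatTrans.isIso_app_iff_of_iso τ ((shiftFunctor T n).mapIso e).symm.op).1 (hX n)
  cone {S} hS h₁ h₂ n :=
    hH.isIso_app_obj₃ hH' τ (Triangle.shift_distinguished S hS n)
      (fun m ↦
        (NatTrans.isIso_app_iff_of_iso τ ((shiftFunctorAdd T n m).app S.obj₁).symm.op).1 (h₁ _))
      (fun m ↦
        (NatTrans.isIso_app_iff_of_iso τ ((shiftFunctorAdd T n m).app S.obj₂).symm.op).1 (h₂ _))
  coproduct X _ hX n :=
    (NatTrans.isIso_app_iff_of_iso τ (PreservesCoproduct.iso (shiftFunctor T n) X).symm.op).2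
      (hH.isIso_app_sigma hH' τ _ fun j ↦ hX j n)

end IsBrownFunctor

end Induction

section CompactGeneration

open Pretriangulated

variable {T : Type u} [Category.{v} T] [Preadditive T] [HasShift T ℤ]
  [∀ n : ℤ, (shiftFunctor T n).Additive]

/-- A set-indexed family of compact objects, stable under shifts up to isomorphism, that detects
the vanishing of objects. -/
structure IsCompactGeneratingFamily {ι : Type v} (S : ι → T) : Prop where
  isCompactObj (i : ι) : IsCompactObj (S i)
  exists_shift_iso (i : ι) (n : ℤ) : ∃ j, Nonempty ((S i)⟦n⟧ ≅ S j)
  isZero (t : T) (ht : ∀ (i : ι) (f : S i ⟶ t), f = 0) : IsZero t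

lemma IsCompactlyGenerated.exists_isCompactGeneratingFamily (hT : IsCompactlyGenerated T) :
    ∃ (ι : Type v) (S : ι → T), IsCompactGeneratingFamily S := by
  obtain ⟨_, ι, G, hG, hG'⟩ := hT
  refine ⟨ι × ℤ, fun i ↦ (G i.1)⟦i.2⟧, fun i ↦ (hG i.1).shift i.2,
    fun i n ↦ ⟨(i.1, i.2 + n), ⟨((shiftFunctorAdd T i.2 n).app _).symm⟩⟩,
    fun t ht ↦ hG' t fun i f ↦ ?_⟩
  have e : (G i)⟦(0 : ℤ)⟧ ≅ G i := (shiftFunctorZero T ℤ).app (G i)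
  rw [← cancel_epi e.hom, comp_zero]
  exact ht (i, 0) _

variable [HasZeroObject T] [Pretriangulated T]

namespace IsCompactGeneratingFamily

variable {ι : Type v} {S : ι → T}

lemma isIso_of_bijective (hS : IsCompactGeneratingFamily S) {X Y : T} (f : X ⟶ Y)
    (hf : ∀ i, Function.Bijective fun g : S i ⟶ X ↦ g ≫ f) : IsIso f := by
  obtain ⟨Z, p, d, hZ⟩ := distinguished_cocone_triangle f
  refine (Triangle.isZero₃_iff_isIso₁ _ hZ).1 (hS.isZero Z fun i φ ↦ ?_)
  have hd : φ ≫ d = 0 := by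
    have h₃₁ : d ≫ f⟦(1 : ℤ)⟧' = 0 := comp_distTriang_mor_zero₃₁ _ hZ
    refine eq_zero_of_comp_shift_map_eq_zero (f := f) (fun w hw ↦ ?_)
      (by rw [Category.assoc, h₃₁, comp_zero])
    obtain ⟨j, ⟨e⟩⟩ := hS.exists_shift_iso i (-1)
    have hew : e.inv ≫ w = 0 := (hf j).1 (by simp [hw])
    rw [← e.hom_inv_id_assoc w, hew, comp_zero]
  obtain ⟨g, rfl⟩ : ∃ g : S i ⟶ Y, φ = g ≫ p := Triangle.coyoneda_exact₃ _ hZ φ hd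
  obtain ⟨g', rfl⟩ := (hf i).2 g
  have h₁₂ : f ≫ p = 0 := comp_distTriang_mor_zero₁₂ _ hZ
  rw [Category.assoc, h₁₂, comp_zero]

lemma prop_of_isLocalizing [HasCoproducts.{v} T] (hS : IsCompactGeneratingFamily S)
    {P : ObjectProperty T} (hP : IsLocalizing P) (hPS : ∀ i, P (S i)) (X : T) : P X := by
  obtain ⟨Z, z, hZ, hz⟩ :=
    (isBrownFunctor_preadditiveYoneda X).exists_bijective_of_isCompactObj S hP hPS hS.isCompactObj
  have : IsIso (C := T) z := hS.isIso_of_bijective z hz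
  exact hP.of_iso (asIso (C := T) z) hZ

end IsCompactGeneratingFamily

namespace IsCompactlyGenerated

lemma isIso_of_bijective (hT : IsCompactlyGenerated T) {X Y : T} (f : X ⟶ Y)
    (hf : ∀ t : T, IsCompactObj t → Function.Bijective fun g : t ⟶ X ↦ g ≫ f) : IsIso f := by
  obtain ⟨ι, S, hS⟩ := hT.exists_isCompactGeneratingFamily
  exact hS.isIso_of_bijective f fun i ↦ hf _ (hS.isCompactObj i)

lemma prop_of_isLocalizing (hT : IsCompactlyGenerated T) {P : ObjectProperty T}
    (hP : IsLocalizing P) (hPc : ∀ t, IsCompactObj t → P t) (X : T) : P X := by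
  have := hT.1
  obtain ⟨ι, S, hS⟩ := hT.exists_isCompactGeneratingFamily
  exact hS.prop_of_isLocalizing hP (fun i ↦ hPc _ (hS.isCompactObj i)) X

lemma isIso_app (hT : IsCompactlyGenerated T) {M M' : T ⥤ AddCommGrpCat.{v}} [M.IsHomological]
    [M'.IsHomological] (hM : PreservesCoproducts M) (hM' : PreservesCoproducts M') (τ : M ⟶ M')
    (hτ : ∀ t, IsCompactObj t → IsIso (τ.app t)) (X : T) : IsIso (τ.app X) := by
  have := hT.1
  exact (NatTrans.isIso_app_iff_of_iso τ ((shiftFunctorZero T ℤ).app X)).1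
    (hT.prop_of_isLocalizing (isLocalizing_isIso_app hM hM' τ) (fun t ht n ↦ hτ _ (ht.shift n)) X 0)

end IsCompactlyGenerated

end CompactGeneration

section BrownRepresentability

variable {T : Type u} [Category.{v} T] [Preadditive T]

/-- The natural transformation `Hom(-, Z) ⟶ H` of functors to abelian groups that corresponds to an
element of `H Z` under the Yoneda lemma. -/
def yonedaTrans (H : Tᵒᵖ ⥤ AddCommGrpCat.{v}) [H.Additive] {Z : T} (z : H.obj (op Z)) :
    preadditiveYoneda.obj Z ⟶ H where
  app X := AddCommGrpCat.ofHom (AddMonoidHom.mk' (fun f : X.unop ⟶ Z ↦ H.map f.op z) fun f g ↦ by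
    change H.map (f.op + g.op) z = _
    rw [H.map_add]
    rfl)
  naturality X Y f := by
    ext g
    exact ConcreteCategory.congr_hom (H.map_comp (X := op Z) (Quiver.Hom.op g) f) z

lemma isIso_yonedaTrans_app_iff {H : Tᵒᵖ ⥤ AddCommGrpCat.{v}} [H.Additive] {Z : T}
    (z : H.obj (op Z)) (X : T) :
    IsIso ((yonedaTrans H z).app (op X)) ↔ Function.Bijective fun f : X ⟶ Z ↦ H.map f.op z :=
  ConcreteCategory.isIso_iff_bijective ((yonedaTrans H z).app (op X))

open Pretriangulated

variable [HasZeroObject T] [HasShift T ℤ] [∀ n : ℤ, (shiftFunctor T n).Additive] [Pretriangulated T]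

theorem IsBrownFunctor.exists_representing (hT : IsCompactlyGenerated T)
    {H : Tᵒᵖ ⥤ AddCommGrpCat.{v}} (hH : IsBrownFunctor H) :
    ∃ (Z : T) (z : H.obj (op Z)), ∀ X : T, Function.Bijective fun f : X ⟶ Z ↦ H.map f.op z := by
  obtain ⟨ι, S, hS⟩ := hT.exists_isCompactGeneratingFamily
  have := hT.1
  have := hH.additive
  obtain ⟨Z, z, -, hz⟩ := hH.exists_bijective_of_isCompactObj S (P := fun _ ↦ True)
    ⟨fun _ _ ↦ trivial, fun _ _ _ ↦ trivial, fun _ _ _ ↦ trivial⟩ (fun _ ↦ trivial) hS.isCompactObj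
  simp only [← isIso_yonedaTrans_app_iff] at hz ⊢
  have hP := (isBrownFunctor_preadditiveYoneda Z).isLocalizing_isIso_app hH (yonedaTrans H z)
  have hX := hS.prop_of_isLocalizing hP fun i n ↦ by
    obtain ⟨j, ⟨e⟩⟩ := hS.exists_shift_iso i n
    exact (NatTrans.isIso_app_iff_of_iso (yonedaTrans H z) e.op).1 (hz j)
  exact ⟨Z, z, fun X ↦ (NatTrans.isIso_app_iff_of_iso (yonedaTrans H z)
    ((shiftFunctorZero T ℤ).symm.app X).op).1 (hX X 0)⟩

end BrownRepresentability

section Adjoints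

variable {T : Type u₁} [Category.{v} T] {T' : Type u₂} [Category.{v} T']

lemma sigmaComparison_comp_functor {E : Type u} [Category.{v} E] (B : T' ⥤ T) (M : T ⥤ E)
    {J : Type v} (X : J → T') [HasCoproduct X] [HasCoproduct fun j ↦ B.obj (X j)]
    [HasCoproduct fun j ↦ M.obj (B.obj (X j))] [HasCoproduct fun j ↦ (B ⋙ M).obj (X j)] :
    sigmaComparison (B ⋙ M) X = sigmaComparison M (fun j ↦ B.obj (X j)) ≫
      M.map (sigmaComparison B X) :=
  Sigma.hom_ext _ _ fun j ↦ by
    refine (ι_comp_sigmaComparison (B ⋙ M) X j).trans (Eq.symm ?_)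
    refine (ι_comp_sigmaComparison_assoc M (fun j ↦ B.obj (X j)) j _).trans ?_
    rw [← M.map_comp, ι_comp_sigmaComparison, Functor.comp_map]

variable [HasZeroObject T] [Preadditive T] [HasShift T ℤ]
  [∀ n : ℤ, (shiftFunctor T n).Additive] [Pretriangulated T] [Preadditive T']

lemma preservesCoproducts_of_adjunction (hT : IsCompactlyGenerated T) [HasCoproducts.{v} T']
    {A : T ⥤ T'} [A.Additive] {B : T' ⥤ T} (adj : A ⊣ B)
    (hA : ∀ t, IsCompactObj t → IsCompactObj (A.obj t)) : PreservesCoproducts B := by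
  intro J
  have := hT.1
  have (X : J → T') : PreservesColimit (Discrete.functor X) B := by
    have : IsIso (sigmaComparison B X) := hT.isIso_of_bijective _ fun t ht ↦ by
      let M := preadditiveCoyoneda.obj (op t)
      have hM := ht J
      have hBM : PreservesColimitsOfShape (Discrete J) (B ⋙ M) :=
        have := hA t ht J
        preservesColimitsOfShape_of_natIso (preadditiveCoyonedaObjIso adj t)
      have : IsIso (M.map (sigmaComparison B X)) := by
        have h : IsIso (sigmaComparison (B ⋙ M) X) := inferInstance
        rw [sigmaComparison_comp_functor B M] at h
        exact IsIso.of_isIso_comp_left (sigmaComparison M fun j ↦ B.obj (X j)) _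
      exact ConcreteCategory.bijective_of_isIso (M.map (sigmaComparison B X))
    exact PreservesCoproduct.of_iso_comparison B X
  exact preservesColimitsOfShape_of_discrete B

variable [HasZeroObject T'] [HasShift T' ℤ] [∀ n : ℤ, (shiftFunctor T' n).Additive]
  [Pretriangulated T']

lemma isBrownFunctor_comp_preadditiveYoneda (A : T ⥤ T') [A.CommShift ℤ] [A.IsTriangulated]
    (hA : PreservesCoproducts A) (t : T') :
    IsBrownFunctor (A.op ⋙ preadditiveYoneda.obj t) where
  additive := inferInstance
  exact hS := (isBrownFunctor_preadditiveYoneda t).exact (A.map_distinguished _ hS)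
  bijective {J} X _ := by
    have := hA J
    let hX := isColimitCofanMkObjOfIsColimit A _ _ (coproductIsCoproduct X)
    exact ⟨fun f g hfg ↦ Cofan.IsColimit.hom_ext hX f g (congr_fun hfg),
      fun g ↦ ⟨Cofan.IsColimit.desc hX g, funext (Cofan.IsColimit.fac hX g)⟩⟩

theorem isLeftAdjoint_of_preservesCoproducts (hT : IsCompactlyGenerated T) (A : T ⥤ T')
    [A.CommShift ℤ] [A.IsTriangulated] (hA : PreservesCoproducts A) : A.IsLeftAdjoint := by
  have (t : T') : ∃ (Z : T) (z : A.obj Z ⟶ t), ∀ X : T,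
      Function.Bijective fun f : X ⟶ Z ↦ A.map f ≫ z :=
    (isBrownFunctor_comp_preadditiveYoneda A hA t).exists_representing hT
  choose Z z hz using this
  exact (Adjunction.adjunctionOfEquivRight (F := A) (G_obj := Z)
    (fun X t ↦ (Equiv.ofBijective _ (hz t X)).symm) (fun X' X t f g ↦ by
      rw [Equiv.symm_apply_eq]
      obtain ⟨g', rfl⟩ := (Equiv.ofBijective _ (hz t X)).surjective g
      simp)).isLeftAdjoint

end Adjoints

section Products

variable {T : Type u} [Category.{v} T] [Preadditive T]

/-- The functor sending `X` to the group of families of morphisms from `X` to the `Y j`; an object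
representing it is a product of the `Y j`. -/
def homFamily {J : Type v} (Y : J → T) : Tᵒᵖ ⥤ AddCommGrpCat.{v} where
  obj X := AddCommGrpCat.of (∀ j, X.unop ⟶ Y j)
  map f := AddCommGrpCat.ofHom (AddMonoidHom.mk' (fun g j ↦ f.unop ≫ g j) fun _ _ ↦ by ext; simp)

variable [HasZeroObject T] [HasShift T ℤ] [∀ n : ℤ, (shiftFunctor T n).Additive] [Pretriangulated T]

lemma isBrownFunctor_homFamily {J : Type v} (Y : J → T) : IsBrownFunctor (homFamily Y) where
  additive := ⟨fun {X X' f g} ↦ by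
    ext h
    exact funext fun j ↦ Preadditive.add_comp _ _ _ f.unop g.unop (h j)⟩
  exact hS := fun f ↦ by
    have h j := (isBrownFunctor_preadditiveYoneda (Y j)).exact hS (f j)
    refine ⟨fun hf ↦ ?_, ?_⟩
    · choose g hg using fun j ↦ (h j).1 (congr_fun hf j)
      exact ⟨g, funext hg⟩
    · rintro ⟨g, rfl⟩
      exact funext fun j ↦ (h j).2 ⟨g j, rfl⟩
  bijective X _ :=
    ⟨fun f g hfg ↦ funext fun j ↦ Sigma.hom_ext _ _ fun i ↦ congr_fun (congr_fun hfg i) j,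
      fun g ↦ ⟨fun j ↦ Sigma.desc fun i ↦ g i j, funext fun i ↦ funext fun j ↦ Sigma.ι_desc _ _⟩⟩

lemma IsCompactlyGenerated.hasProducts (hT : IsCompactlyGenerated T) : HasProducts.{v} T := by
  have {J : Type v} (Y : J → T) : ∃ (Z : T) (z : ∀ j, Z ⟶ Y j), ∀ X : T,
      Function.Bijective fun (f : X ⟶ Z) j ↦ f ≫ z j :=
    (isBrownFunctor_homFamily Y).exists_representing hT
  choose Z z hz using @this
  refine hasProducts_of_limit_fans (fun Y ↦ Fan.mk (Z Y) (z Y)) fun Y ↦ Fan.IsLimit.mk _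
    (fun s ↦ ((hz Y s.pt).2 s.proj).choose) (fun s ↦ congr_fun ((hz Y s.pt).2 s.proj).choose_spec)
    fun s m hm ↦ (hz Y s.pt).1 ?_
  exact (funext hm).trans ((hz Y s.pt).2 s.proj).choose_spec.symm

end Products

section Idempotents

open Pretriangulated

variable {T : Type u} [Category.{v} T] [HasZeroObject T] [Preadditive T] [HasShift T ℤ]
  [∀ n : ℤ, (shiftFunctor T n).Additive] [Pretriangulated T]

/- The witness is the homotopy colimit of `X ⟶ X ⟶ X ⟶ ⋯`, all maps being `e`. -/
lemma exists_comp_eq_of_idempotent [HasCoproducts.{v} T] {X : T} {e : X ⟶ X} (he : e ≫ e = e) :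
    ∃ (Z : T) (p : X ⟶ Z) (r : Z ⟶ X), p ≫ r = e ∧ e ≫ p = p ∧
      ∀ t, IsCompactObj t → ∀ f : t ⟶ Z, ∃ g, f = g ≫ p := by
  obtain ⟨Z, q, d, hZ⟩ := distinguished_cocone_triangle (oneSubShift (fun _ ↦ X) (fun _ ↦ e))
  let p (n : ℕ) : X ⟶ Z := seqι (fun _ ↦ X) n ≫ q
  have hp (n : ℕ) : p n = e ≫ p (n + 1) := seqι_comp_eq (fun _ ↦ X) (fun _ ↦ e) hZ n
  have hep (n : ℕ) : e ≫ p n = p n := by rw [hp n, reassoc_of% he]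
  have hp₀ (n : ℕ) : p n = p 0 := by
    induction n with
    | zero => rfl
    | succ n h => rw [← h, hp n, hep]
  let a : seqCoproduct (fun _ : ℕ ↦ X) ⟶ X := Limits.Sigma.desc fun _ ↦ e
  have ha (n : ℕ) : seqι (fun _ : ℕ ↦ X) n ≫ a = e := Limits.Sigma.ι_desc _ _
  have ha₀ : oneSubShift (fun _ ↦ X) (fun _ ↦ e) ≫ a = 0 := seqCoproduct_hom_ext fun n ↦ by
    rw [seqι_oneSubShift_comp, ha, ha, he, sub_self, comp_zero]
  obtain ⟨r, hr⟩ : ∃ r : Z ⟶ X, a = q ≫ r := Triangle.yoneda_exact₂ _ hZ a ha₀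
  refine ⟨Z, p 0, r, ?_, hep 0, fun t ht f ↦ ?_⟩
  · rw [Category.assoc, ← hr, ha]
  · obtain ⟨n, g, hg⟩ := ht.exists_factor_seqι (fun _ ↦ X) (fun _ ↦ e) hZ f
    exact ⟨g, by rw [← hp₀ n, hg]⟩

lemma IsCompactlyGenerated.isIdempotentComplete (hT : IsCompactlyGenerated T) :
    IsIdempotentComplete T where
  idempotents_split X e he := by
    have := hT.1
    obtain ⟨Z, p, r, hpr, hep, hp⟩ := exists_comp_eq_of_idempotent he
    have hrp {t : T} (ht : IsCompactObj t) (f : t ⟶ Z) : f ≫ r ≫ p = f := by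
      obtain ⟨g, rfl⟩ := hp t ht f
      rw [Category.assoc, reassoc_of% hpr, hep]
    have : IsIso (r ≫ p) := hT.isIso_of_bijective _ fun t ht ↦ by
      simp only [hrp ht]
      exact Function.bijective_id
    have h : p ≫ inv (r ≫ p) = p := by rw [IsIso.comp_inv_eq, reassoc_of% hpr, hep]
    exact ⟨Z, inv (r ≫ p) ≫ r, p, by simp, by rw [reassoc_of% h, hpr]⟩

end Idempotents

section EssentiallySmall

open Pretriangulated ObjectProperty

variable {T : Type u} [Category.{v} T]

lemma exists_family_of_essentiallySmall (P : ObjectProperty T)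
    [ObjectProperty.EssentiallySmall.{v} P] :
    ∃ (κ : Type v) (k : κ → T), ∀ X, P X → ∃ a, Nonempty (X ≅ k a) := by
  obtain ⟨Q, _, -, hPQ⟩ := ObjectProperty.EssentiallySmall.exists_small_le.{v} P
  refine ⟨Shrink.{v} (Subtype Q), fun a ↦ ((equivShrink _).symm a).1, fun X hX ↦ ?_⟩
  obtain ⟨Y, hY, ⟨e⟩⟩ := hPQ X hX
  exact ⟨equivShrink _ ⟨Y, hY⟩, ⟨e ≪≫ eqToIso (by simp)⟩⟩

lemma essentiallySmall_of_family {P : ObjectProperty T} {κ : Type v} (k : κ → T)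
    (hP : ∀ X, P X → ∃ a, Nonempty (X ≅ k a)) : ObjectProperty.EssentiallySmall.{v} P where
  exists_small_le' := ⟨.ofObj k, inferInstance, fun X hX ↦
    have ⟨a, e⟩ := hP X hX
    ⟨k a, ofObj_apply k a, e⟩⟩

variable [HasShift T ℤ]

instance (P : ObjectProperty T) [ObjectProperty.EssentiallySmall.{v} P] :
    ObjectProperty.EssentiallySmall.{v} (P.shiftClosure ℤ) := by
  obtain ⟨κ, k, hk⟩ := exists_family_of_essentiallySmall P
  refine essentiallySmall_of_family (fun a : κ × ULift.{v} ℤ ↦ (k a.1)⟦a.2.down⟧) ?_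
  rintro X ⟨Y, n, e, hY⟩
  obtain ⟨a, ⟨e'⟩⟩ := hk Y hY
  exact ⟨⟨a, ⟨n⟩⟩, ⟨e ≪≫ (shiftFunctor T n).mapIso e'⟩⟩

variable [HasZeroObject T] [Preadditive T] [∀ n : ℤ, (shiftFunctor T n).Additive]
  [Pretriangulated T]

/- An extension of `Z` by `Y` is determined up to isomorphism by its class `Z ⟶ Y⟦1⟧`. -/
instance (P Q : ObjectProperty T) [ObjectProperty.EssentiallySmall.{v} P]
    [ObjectProperty.EssentiallySmall.{v} Q] :
    ObjectProperty.EssentiallySmall.{v} (extensionProduct P Q) := by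
  obtain ⟨κ, k, hk⟩ := exists_family_of_essentiallySmall P
  obtain ⟨κ', k', hk'⟩ := exists_family_of_essentiallySmall Q
  refine essentiallySmall_of_family (fun a : Σ (i : κ) (j : κ'), k' j ⟶ (k i)⟦(1 : ℤ)⟧ ↦
    (distinguished_cocone_triangle₂ a.2.2).choose) ?_
  rintro X ⟨Y, Z, f, g, h, hT, hY, hZ⟩
  obtain ⟨i, ⟨eY⟩⟩ := hk Y hY
  obtain ⟨j, ⟨eZ⟩⟩ := hk' Z hZ
  let h' : k' j ⟶ (k i)⟦(1 : ℤ)⟧ := eZ.inv ≫ h ≫ eY.hom⟦(1 : ℤ)⟧'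
  obtain ⟨f', g', hT'⟩ := (distinguished_cocone_triangle₂ h').choose_spec
  exact ⟨⟨i, j, h'⟩, ⟨Triangle.π₂.mapIso (isoTriangleOfIso₁₃ _ _ hT hT' eY eZ
    (eZ.hom_inv_id_assoc _).symm)⟩⟩

instance (P : ObjectProperty T) [ObjectProperty.EssentiallySmall.{v} P] :
    ObjectProperty.EssentiallySmall.{v} P.triangEnvelope := by
  have h (Q : ObjectProperty T) [ObjectProperty.EssentiallySmall.{v} Q] (n : ℕ) :
      ObjectProperty.EssentiallySmall.{v} (Q.extensionProductIter n) := by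
    induction n with
    | zero => assumption
    | succ n h =>
      rw [extensionProductIter_succ]
      infer_instance
  unfold triangEnvelope
  infer_instance

end EssentiallySmall

section CompactSubcategory

open Pretriangulated ZeroObject

variable {T : Type u} [Category.{v} T] [Preadditive T] [HasCoproducts.{v} T]

variable (T) in
/-- The compact objects of a category, as a property of objects, so that its closure properties
can be registered as instances. -/
def compactObjects : ObjectProperty T := IsCompactObj

instance : (compactObjects T).IsStableUnderRetracts where
  of_retract r hX := IsCompactObj.of_retract hX r.i r.r r.retract

instance [HasZeroObject T] : (compactObjects T).ContainsZero where
  exists_zero := ⟨0, isZero_zero T, isCompactObj_of_mem_iSup fun _ _ f ↦ by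
    rw [(isZero_zero T).eq_zero_of_src f]
    exact zero_mem _⟩

variable [HasShift T ℤ] [∀ n : ℤ, (shiftFunctor T n).Additive]

instance : (compactObjects T).IsStableUnderShift ℤ where
  isStableUnderShiftBy n := ⟨fun _ hX ↦ IsCompactObj.shift hX n⟩

variable [HasZeroObject T] [Pretriangulated T]

instance : (compactObjects T).IsTriangulated :=
  have : (compactObjects T).IsTriangulatedClosed₃ := .mk' fun _ hS h₁ h₂ ↦ .cone hS h₁ h₂
  { toIsTriangulatedClosed₂ := .of_isTriangulatedClosed₃ }

end CompactSubcategory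

section WeakPushouts

open Pretriangulated

variable {T : Type u} [Category.{v} T] [HasZeroObject T] [Preadditive T] [HasShift T ℤ]
  [∀ n : ℤ, (shiftFunctor T n).Additive] [Pretriangulated T] (Q : ObjectProperty T)
  [Q.IsTriangulated] [Q.IsClosedUnderIsomorphisms]

lemma prop_biprod {X Y : T} (hX : Q X) (hY : Q Y) : Q (X ⊞ Y) :=
  Q.ext_of_isTriangulatedClosed₂ _ (binaryBiproductTriangle_distinguished X Y) hX hY

lemma exists_weakCokernel {w x : T} (hw : Q w) (hx : Q x) (i : w ⟶ x) :
    ∃ (c : T) (_ : Q c) (p : x ⟶ c), i ≫ p = 0 ∧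
      ∀ {Y : T} (f : x ⟶ Y), i ≫ f = 0 → ∃ g : c ⟶ Y, p ≫ g = f := by
  obtain ⟨c, p, d, hc⟩ := distinguished_cocone_triangle i
  refine ⟨c, Q.ext_of_isTriangulatedClosed₃ _ hc hw hx, p, comp_distTriang_mor_zero₁₂ _ hc,
    fun f hf ↦ ?_⟩
  obtain ⟨g, hg⟩ := Triangle.yoneda_exact₂ _ hc f hf
  exact ⟨g, hg.symm⟩

lemma exists_weakPushout {w x y : T} (hw : Q w) (hx : Q x) (hy : Q y) (i : w ⟶ x) (j : w ⟶ y) :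
    ∃ (c : T) (_ : Q c) (a : x ⟶ c) (b : y ⟶ c), i ≫ a = j ≫ b ∧
      ∀ {Y : T} (f : x ⟶ Y) (g : y ⟶ Y), i ≫ f = j ≫ g →
        ∃ h : c ⟶ Y, a ≫ h = f ∧ b ≫ h = g := by
  obtain ⟨c, hc, p, hp, hp'⟩ := exists_weakCokernel Q hw (prop_biprod Q hx hy) (biprod.lift i (-j))
  refine ⟨c, hc, biprod.inl ≫ p, biprod.inr ≫ p, ?_, fun f g hfg ↦ ?_⟩
  · rw [← sub_eq_zero, ← hp, biprod.lift_eq, Preadditive.add_comp]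
    simp [sub_eq_add_neg]
  · obtain ⟨h, hh⟩ := hp' (biprod.desc f g) (by simp [biprod.lift_desc, hfg])
    exact ⟨h, by simp [hh], by simp [hh]⟩

end WeakPushouts

section Finitary

open Pretriangulated ZeroObject

variable {T : Type u} [Category.{v} T]

/-- The element `m` of `M X` is the image of an element of `M x` under a morphism `x ⟶ X` from an
object `x` in `Q`. -/
def ComesFrom (M : T ⥤ AddCommGrpCat.{v}) (Q : ObjectProperty T) {X : T} (m : M.obj X) : Prop :=
  ∃ (x : T) (_ : Q x) (f : x ⟶ X) (k : M.obj x), M.map f k = m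

/-- `M X` is the colimit of the `M x`, over the objects `x` over `X` that are in `Q`: every element
of `M X` comes from some `x`, and what vanishes in `M X` already vanishes at some stage. -/
structure IsFinitary (M : T ⥤ AddCommGrpCat.{v}) (Q : ObjectProperty T) (X : T) : Prop where
  comesFrom (m : M.obj X) : ComesFrom M Q m
  factors {x : T} (hx : Q x) (f : x ⟶ X) (m : M.obj x) (hm : M.map f m = 0) :
    ∃ (x' : T) (_ : Q x') (g : x ⟶ x') (h : x' ⟶ X), g ≫ h = f ∧ M.map g m = 0

variable {M : T ⥤ AddCommGrpCat.{v}} {Q : ObjectProperty T}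

lemma ComesFrom.map {X Y : T} {m : M.obj X} (h : ComesFrom M Q m) (f : X ⟶ Y) :
    ComesFrom M Q (M.map f m) := by
  obtain ⟨x, hx, g, m', rfl⟩ := h
  exact ⟨x, hx, g ≫ f, m', M.map_comp_apply g f m'⟩

namespace IsFinitary

lemma of_iso {X Y : T} (hX : IsFinitary M Q X) (e : X ≅ Y) : IsFinitary M Q Y where
  comesFrom m := by
    have := (hX.comesFrom (M.map e.inv m)).map e.hom
    rwa [← M.map_comp_apply, e.inv_hom_id, M.map_id] at this
  factors hx f m hm := by
    obtain ⟨x', hx', g, h, hgh, hg⟩ := hX.factors hx (f ≫ e.inv) m (by simp [hm])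
    exact ⟨x', hx', g, h ≫ e.hom, by rw [← Category.assoc, hgh]; simp, hg⟩

lemma of_prop {X : T} (hX : Q X) : IsFinitary M Q X where
  comesFrom m := ⟨X, hX, 𝟙 X, m, by simp⟩
  factors _ f _ hm := ⟨X, hX, f, 𝟙 X, by simp, hm⟩

end IsFinitary

variable [HasZeroObject T] [Preadditive T] [HasShift T ℤ] [∀ n : ℤ, (shiftFunctor T n).Additive]
  [Pretriangulated T] [Q.IsTriangulated] [Q.IsClosedUnderIsomorphisms]

lemma ComesFrom.zero (X : T) : ComesFrom M Q (0 : M.obj X) :=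
  ⟨0, Q.prop_zero, 0, 0, map_zero _⟩

lemma ComesFrom.add {X : T} {m m' : M.obj X} (h : ComesFrom M Q m) (h' : ComesFrom M Q m') :
    ComesFrom M Q (m + m') := by
  obtain ⟨x, hx, g, m, rfl⟩ := h
  obtain ⟨x', hx', g', m', rfl⟩ := h'
  refine ⟨x ⊞ x', prop_biprod Q hx hx', biprod.desc g g',
    M.map biprod.inl m + M.map biprod.inr m', ?_⟩
  rw [map_add, ← M.map_comp_apply, ← M.map_comp_apply, biprod.inl_desc, biprod.inr_desc]

namespace IsFinitary

section Triangles

variable [M.IsHomological] {S : Triangle T}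

lemma comesFrom_obj₂ (hS : S ∈ distTriang T) (h₁ : IsFinitary M Q S.obj₁)
    (h₁' : IsFinitary M Q (S.obj₁⟦(1 : ℤ)⟧)) (h₃ : IsFinitary M Q S.obj₃) (m : M.obj S.obj₂) :
    ComesFrom M Q m := by
  obtain ⟨z, hz, f, mz, hf⟩ := h₃.comesFrom (M.map S.mor₂ m)
  obtain ⟨x, hx, g, h, hgh, hg⟩ := h₁'.factors hz (f ≫ S.mor₃) mz (by
    rw [M.map_comp_apply, hf]
    exact (exact_map_of_distTriang M (rot_of_distTriang _ hS)).apply_apply_eq_zero m)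
  obtain ⟨y, a, d, hy⟩ := distinguished_cocone_triangle₁ g
  obtain ⟨my, hmy⟩ : ∃ my : M.obj y, M.map a my = mz := (exact_map_of_distTriang M hy mz).1 hg
  obtain ⟨fy, hfy, -⟩ := complete_distinguished_triangle_morphism₁ _ _ hy
    (rot_of_distTriang _ hS) f h hgh
  change y ⟶ S.obj₂ at fy
  change a ≫ f = fy ≫ S.mor₂ at hfy
  obtain ⟨mx, hmx⟩ := (exact_map_of_distTriang M hS (m - M.map fy my)).1 (by
    rw [map_sub, ← M.map_comp_apply, ← hfy, M.map_comp_apply, hmy, hf, sub_self])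
  rw [← sub_add_cancel m (M.map fy my), ← hmx]
  exact ((h₁.comesFrom mx).map _).add
    ⟨y, Q.ext_of_isTriangulatedClosed₁ _ hy hz hx, fy, my, rfl⟩

lemma factors_comp_mor₁ (hS : S ∈ distTriang T) (h₁ : IsFinitary M Q S.obj₁)
    (h₃ : IsFinitary M Q (S.obj₃⟦(-1 : ℤ)⟧)) {w : T} (hw : Q w) (f : w ⟶ S.obj₁) (m : M.obj w)
    (hm : M.map (f ≫ S.mor₁) m = 0) :
    ∃ (w' : T) (_ : Q w') (g : w ⟶ w') (h : w' ⟶ S.obj₂), g ≫ h = f ≫ S.mor₁ ∧ M.map g m = 0 := by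
  have hS' := inv_rot_of_distTriang _ hS
  let j : S.obj₃⟦(-1 : ℤ)⟧ ⟶ S.obj₁ := S.invRotate.mor₁
  have hj : j ≫ S.mor₁ = 0 := comp_distTriang_mor_zero₁₂ _ hS'
  obtain ⟨m', hm'⟩ : ∃ m', M.map j m' = M.map f m :=
    (exact_map_of_distTriang M hS' (M.map f m)).1 ((M.map_comp_apply f S.mor₁ m).symm.trans hm)
  obtain ⟨v, hv, k, mv, rfl⟩ := h₃.comesFrom m'
  obtain ⟨x, hx, p, q, hpq, hp⟩ := h₁.factors (prop_biprod Q hw hv) (biprod.desc f (-(k ≫ j)))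
    (M.map biprod.inl m + M.map biprod.inr mv) (by
      rw [map_add, ← M.map_comp_apply, ← M.map_comp_apply, biprod.inl_desc, biprod.inr_desc,
        M.map_neg, ← hm', ← M.map_comp_apply]
      exact add_neg_cancel _)
  obtain ⟨c, hc, r, hr, hr'⟩ := exists_weakCokernel Q hv hx (biprod.inr ≫ p)
  obtain ⟨s, hs⟩ := hr' (q ≫ S.mor₁) (by
    rw [Category.assoc, reassoc_of% hpq, biprod.inr_desc_assoc, Preadditive.neg_comp,
      Category.assoc, hj, comp_zero, neg_zero])
  refine ⟨c, hc, biprod.inl ≫ p ≫ r, s, ?_, ?_⟩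
  · rw [Category.assoc, Category.assoc, hs, reassoc_of% hpq, biprod.inl_desc_assoc]
  · have h : M.map (p ≫ r) (M.map biprod.inl m + M.map biprod.inr mv) = 0 := by
      rw [M.map_comp_apply, hp, map_zero]
    rw [map_add, ← M.map_comp_apply, ← M.map_comp_apply, ← Category.assoc biprod.inr, hr,
      M.map_zero] at h
    exact (add_zero _).symm.trans h

lemma factors_obj₂ (hS : S ∈ distTriang T) (h₁ : IsFinitary M Q S.obj₁)
    (h₃ : IsFinitary M Q S.obj₃) (h₃' : IsFinitary M Q (S.obj₃⟦(-1 : ℤ)⟧)) {y : T} (hy : Q y)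
    (f : y ⟶ S.obj₂) (m : M.obj y) (hm : M.map f m = 0) :
    ∃ (y' : T) (_ : Q y') (g : y ⟶ y') (h : y' ⟶ S.obj₂), g ≫ h = f ∧ M.map g m = 0 := by
  obtain ⟨z, hz, g, h, hgh, hg⟩ := h₃.factors hy (f ≫ S.mor₂) m (by simp [hm])
  obtain ⟨w, i, d, hw⟩ := distinguished_cocone_triangle₁ g
  obtain ⟨mw, rfl⟩ : ∃ mw : M.obj w, M.map i mw = m := (exact_map_of_distTriang M hw m).1 hg
  obtain ⟨fw, hfw, -⟩ := complete_distinguished_triangle_morphism₁ _ _ hw hS f h hgh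
  change w ⟶ S.obj₁ at fw
  change i ≫ f = fw ≫ S.mor₁ at hfw
  have hQw : Q w := Q.ext_of_isTriangulatedClosed₁ _ hw hy hz
  obtain ⟨w', hw', r, s, hrs, hr⟩ := factors_comp_mor₁ hS h₁ h₃' hQw fw mw
    (by rw [← hfw, M.map_comp_apply, hm])
  obtain ⟨y', hy', a, b, hab, hy''⟩ := exists_weakPushout Q hQw hy hw' i r
  obtain ⟨t, ht, -⟩ := hy'' f s (hfw.trans hrs.symm)
  exact ⟨y', hy', a, t, ht, by rw [← M.map_comp_apply, hab, M.map_comp_apply, hr, map_zero]⟩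

lemma obj₂ (hS : S ∈ distTriang T) (h₁ : IsFinitary M Q S.obj₁)
    (h₁' : IsFinitary M Q (S.obj₁⟦(1 : ℤ)⟧)) (h₃ : IsFinitary M Q S.obj₃)
    (h₃' : IsFinitary M Q (S.obj₃⟦(-1 : ℤ)⟧)) : IsFinitary M Q S.obj₂ :=
  ⟨comesFrom_obj₂ hS h₁ h₁' h₃, factors_obj₂ hS h₁ h₃ h₃'⟩

end Triangles

lemma sigma (hQ : ∀ X, Q X → IsCompactObj X) (hM : PreservesCoproducts M) [M.Additive] {J : Type v}
    (X : J → T) [HasCoproduct X] (hX : ∀ j, IsFinitary M Q (X j)) : IsFinitary M Q (∐ X) where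
  comesFrom m := by
    obtain ⟨s, g, rfl⟩ := (isSumGenerated_of_preservesCoproducts M hM).exists_eq_sum X m
    exact Finset.sum_induction _ (ComesFrom M Q) (fun _ _ ↦ .add) (.zero _) fun j _ ↦
      ((hX j).comesFrom (g j)).map _
  factors {x} hx f m hm := by
    obtain ⟨s, g, rfl⟩ := (hQ x hx).exists_eq_sum X f
    classical
    have hg (j : J) (hj : j ∈ s) : M.map (g j) m = 0 := by
      rw [← sum_comp_sigmaι_π X s g hj, M.map_comp_apply, hm, map_zero]
    clear hm
    induction s using Finset.cons_induction with
    | empty => exact ⟨0, Q.prop_zero, 0, 0, by simp, by simp⟩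
    | cons j s hj ih =>
      obtain ⟨x', hx', a, b, hab, ha⟩ := ih fun k hk ↦ hg k (Finset.mem_cons_of_mem hk)
      obtain ⟨x'', hx'', a', b', hab', ha'⟩ :=
        (hX j).factors hx (g j) m (hg j (Finset.mem_cons_self j s))
      refine ⟨x' ⊞ x'', prop_biprod Q hx' hx'', biprod.lift a a', biprod.desc b (b' ≫ Sigma.ι X j),
        ?_, ?_⟩
      · rw [biprod.lift_desc, hab, reassoc_of% hab', Finset.sum_cons, add_comm]
      · rw [biprod.lift_eq, M.map_add]
        change M.map (a ≫ biprod.inl) m + M.map (a' ≫ biprod.inr) m = 0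
        simp [ha, ha']

end IsFinitary

lemma isLocalizing_isFinitary [HasCoproducts.{v} T] (hQ : Q ≤ compactObjects T)
    [M.IsHomological] (hM : PreservesCoproducts M) :
    IsLocalizing fun X : T ↦ ∀ n : ℤ, IsFinitary M Q (X⟦n⟧) where
  of_iso e hX n := (hX n).of_iso ((shiftFunctor T n).mapIso e)
  cone {S} hS h₁ h₂ n :=
    .obj₂ (rot_of_distTriang _ (Triangle.shift_distinguished S hS n)) (h₂ n)
      ((h₂ (n + 1)).of_iso ((shiftFunctorAdd T n 1).app _))
      ((h₁ (n + 1)).of_iso ((shiftFunctorAdd T n 1).app _))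
      ((h₁ n).of_iso ((shiftEquiv T (1 : ℤ)).unitIso.app _))
  coproduct X _ hX n :=
    (IsFinitary.sigma hQ hM _ fun j ↦ hX j n).of_iso
      (PreservesCoproduct.iso (shiftFunctor T n) X).symm

end Finitary

section Products

variable {T : Type u} [Category.{v} T] {M : T ⥤ AddCommGrpCat.{v}} {J : Type v} (Y : J → T)
  [HasProduct Y]

lemma exists_map_π_eq (hM : PreservesProducts M) (m : ∀ j, M.obj (Y j)) :
    ∃ m' : M.obj (∏ᶜ Y), ∀ j, M.map (Pi.π Y j) m' = m j := by
  have := hM J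
  let c := isLimitFanMkObjOfIsLimit M _ _ (productIsProduct Y)
  let a : AddCommGrpCat.of (∀ j, M.obj (Y j)) ⟶ M.obj (∏ᶜ Y) :=
    Fan.IsLimit.lift c fun j ↦ AddCommGrpCat.ofHom (Pi.evalAddMonoidHom _ j)
  have ha (j : J) : a ≫ M.map (Pi.π Y j) = AddCommGrpCat.ofHom (Pi.evalAddMonoidHom _ j) :=
    Fan.IsLimit.fac c _ j
  exact ⟨a m, fun j ↦ ConcreteCategory.congr_hom (ha j) m⟩

lemma eq_zero_of_map_π_eq_zero (hM : PreservesProducts M) (m : M.obj (∏ᶜ Y))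
    (hm : ∀ j, M.map (Pi.π Y j) m = 0) : m = 0 := by
  have := hM J
  let c := isLimitFanMkObjOfIsLimit M _ _ (productIsProduct Y)
  let a : AddCommGrpCat.of (ULift.{v} ℤ) ⟶ M.obj (∏ᶜ Y) :=
    AddCommGrpCat.ofHom ((zmultiplesHom _ m).comp AddEquiv.ulift.toAddMonoidHom)
  have ha : a = 0 := Fan.IsLimit.hom_ext c _ _ fun j ↦ by
    ext n
    change M.map (Pi.π Y j) (n.down • m) = M.map (Pi.π Y j) 0
    rw [map_zsmul, hm, smul_zero, map_zero]
  calc m = a ⟨1⟩ := (one_zsmul m).symm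
    _ = 0 := by rw [ha]; rfl

end Products

section Corepresentability

open Pretriangulated ZeroObject

variable {T : Type u} [Category.{v} T]

/-- Every element of every `M Y` is the image of `m` under some morphism: the existence half of the
universal property of an element corepresenting `M`. -/
def IsWeaklyUniversal (M : T ⥤ AddCommGrpCat.{v}) {x : T} (m : M.obj x) : Prop :=
  ∀ {Y : T} (y : M.obj Y), ∃ g : x ⟶ Y, M.map g m = y

section

variable {M : T ⥤ AddCommGrpCat.{v}} (hM : PreservesProducts M) [HasProducts.{v} T]
  {Q : ObjectProperty T} [ObjectProperty.EssentiallySmall.{v} Q]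
  (hQ : ∀ X, IsFinitary M Q X)

include hM hQ

lemma exists_isWeaklyUniversal : ∃ (x : T) (_ : Q x) (m : M.obj x), IsWeaklyUniversal M m := by
  obtain ⟨κ, k, hk⟩ := exists_family_of_essentiallySmall Q
  let K (j : Σ a : κ, M.obj (k a)) : T := k j.1
  obtain ⟨p, hp⟩ := exists_map_π_eq K hM fun j ↦ j.2
  obtain ⟨x, hx, f, m, rfl⟩ := (hQ _).comesFrom p
  refine ⟨x, hx, m, fun y ↦ ?_⟩
  obtain ⟨t, ht, g, y', rfl⟩ := (hQ _).comesFrom y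
  obtain ⟨a, ⟨e⟩⟩ := hk t ht
  refine ⟨f ≫ Pi.π K ⟨a, M.map e.hom y'⟩ ≫ e.inv ≫ g, ?_⟩
  rw [M.map_comp_apply, M.map_comp_apply, hp, ← M.map_comp_apply e.hom, e.hom_inv_id_assoc]

lemma exists_forall_factors_of_map_eq_zero {x : T} (hx : Q x) (m : M.obj x) :
    ∃ (x' : T) (_ : Q x') (h : x ⟶ x'), M.map h m = 0 ∧
      ∀ {Y : T} (g : x ⟶ Y), M.map g m = 0 → ∃ g' : x' ⟶ Y, h ≫ g' = g := by
  obtain ⟨κ, k, hk⟩ := exists_family_of_essentiallySmall Q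
  let K (j : Σ a : κ, { g : x ⟶ k a // M.map g m = 0 }) : T := k j.1
  obtain ⟨x', hx', h, l, hl, hh⟩ := (hQ _).factors hx (Pi.lift fun j ↦ j.2.1 : x ⟶ ∏ᶜ K) m
    (eq_zero_of_map_π_eq_zero K hM _ fun j ↦ by
      rw [← M.map_comp_apply, Pi.lift_π]
      exact j.2.2)
  refine ⟨x', hx', h, hh, fun g hg ↦ ?_⟩
  obtain ⟨t, ht, b, c, rfl, hb⟩ := (hQ _).factors hx g m hg
  obtain ⟨a, ⟨e⟩⟩ := hk t ht
  refine ⟨l ≫ Pi.π K ⟨a, b ≫ e.hom, by rw [M.map_comp_apply, hb, map_zero]⟩ ≫ e.inv ≫ c, ?_⟩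
  rw [reassoc_of% hl, Pi.lift_π_assoc, Category.assoc, e.hom_inv_id_assoc]

end

lemma IsWeaklyUniversal.exists_retract_bijective [Preadditive T] [IsIdempotentComplete T]
    {M : T ⥤ AddCommGrpCat.{v}} [M.Additive] {x : T} {m : M.obj x} (hm : IsWeaklyUniversal M m)
    (e : x ⟶ x) (he : M.map e m = m)
    (he' : ∀ {Y : T} (g : x ⟶ Y), M.map g m = 0 → e ≫ g = 0) :
    ∃ (Z : T) (_ : Retract Z x) (z : M.obj Z), ∀ Y : T,
      Function.Bijective fun f : Z ⟶ Y ↦ M.map f z := by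
  have map_sub {X Y : T} (f g : X ⟶ Y) (a : M.obj X) :
      M.map (f - g) a = M.map f a - M.map g a := by
    rw [M.map_sub]
    rfl
  have hee : e ≫ e = e := by
    have := he' (𝟙 x - e) (by rw [map_sub, he, M.map_id]; exact sub_self m)
    rwa [Preadditive.comp_sub, Category.comp_id, sub_eq_zero, eq_comm] at this
  obtain ⟨Z, i, p, hip, rfl⟩ := IsIdempotentComplete.idempotents_split x e hee
  refine ⟨Z, ⟨i, p, hip⟩, M.map p m, fun Y ↦ ⟨fun g g' h ↦ ?_, fun y ↦ ?_⟩⟩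
  · have h₀ := he' (p ≫ (g - g')) (by rw [M.map_comp_apply, map_sub]; exact sub_eq_zero.2 h)
    rw [Category.assoc, reassoc_of% hip] at h₀
    rw [← sub_eq_zero, ← Category.id_comp (g - g'), ← hip, Category.assoc, h₀, comp_zero]
  · obtain ⟨g, rfl⟩ := hm y
    refine ⟨i ≫ g, ?_⟩
    dsimp only
    rw [← M.map_comp_apply, ← Category.assoc, M.map_comp_apply, he]

variable [HasZeroObject T] [Preadditive T] [HasShift T ℤ]
  [∀ n : ℤ, (shiftFunctor T n).Additive] [Pretriangulated T]

lemma exists_retract_bijective [IsIdempotentComplete T] [HasProducts.{v} T]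
    {M : T ⥤ AddCommGrpCat.{v}} [M.IsHomological] (hM : PreservesProducts M) {Q : ObjectProperty T}
    [ObjectProperty.EssentiallySmall.{v} Q] [Q.IsTriangulated] [Q.IsStableUnderRetracts]
    (hQ : ∀ X, IsFinitary M Q X) :
    ∃ (Z : T) (_ : Q Z) (z : M.obj Z), ∀ Y : T, Function.Bijective fun f : Z ⟶ Y ↦ M.map f z := by
  obtain ⟨x, hx, m, hm⟩ := exists_isWeaklyUniversal hM hQ
  obtain ⟨x', hx', h, hhm, hh⟩ := exists_forall_factors_of_map_eq_zero hM hQ hx m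
  obtain ⟨w, i, d, hw⟩ := distinguished_cocone_triangle₁ h
  obtain ⟨n, rfl⟩ : ∃ n : M.obj w, M.map i n = m := (exact_map_of_distTriang M hw m).1 hhm
  have hn : IsWeaklyUniversal M n := fun y ↦
    have ⟨g, hg⟩ := hm y
    ⟨i ≫ g, by rw [M.map_comp_apply, hg]⟩
  obtain ⟨a, ha⟩ := hm n
  obtain ⟨Z, r, z, hz⟩ := hn.exists_retract_bijective (i ≫ a) (by rw [M.map_comp_apply, ha])
    fun g hg ↦ by
      obtain ⟨g', hg'⟩ := hh (a ≫ g) (by rw [M.map_comp_apply, ha, hg])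
      have hih : i ≫ h = 0 := comp_distTriang_mor_zero₁₂ _ hw
      rw [Category.assoc, ← hg', reassoc_of% hih, zero_comp]
  exact ⟨Z, Q.prop_of_retract r (Q.ext_of_isTriangulatedClosed₁ _ hw hx hx'), z, hz⟩

theorem IsCompactlyGenerated.exists_corepresenting [IsTriangulated T] (hT : IsCompactlyGenerated T)
    {M : T ⥤ AddCommGrpCat.{v}} [M.IsHomological] (hM : PreservesCoproducts M)
    (hM' : PreservesProducts M) :
    ∃ (Z : T) (_ : IsCompactObj Z) (z : M.obj Z), ∀ Y : T,
      Function.Bijective fun f : Z ⟶ Y ↦ M.map f z := by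
  have := hT.1
  have := hT.hasProducts
  have := hT.isIdempotentComplete
  obtain ⟨ι, S, hS⟩ := hT.exists_isCompactGeneratingFamily
  let P : ObjectProperty T := .ofObj fun i : Option ι ↦ i.elim 0 S
  have : P.Nonempty := ⟨0, ObjectProperty.ofObj_apply _ none⟩
  have hP : P.triangEnvelope ≤ compactObjects T :=
    (ObjectProperty.triangEnvelope_le_iff _).2 <| (ObjectProperty.ofObj_le_iff _ _).2 fun
      | none => (compactObjects T).prop_zero
      | some i => hS.isCompactObj i
  have hfin (X : T) : IsFinitary M P.triangEnvelope X :=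
    (hS.prop_of_isLocalizing (isLocalizing_isFinitary hP hM) (fun i n ↦
      .of_prop (P.triangEnvelope.le_shift n _
        (P.le_triangEnvelope _ (ObjectProperty.ofObj_apply _ (some i))))) X 0).of_iso
      ((shiftFunctorZero T ℤ).app X)
  obtain ⟨Z, hZ, z, hz⟩ := exists_retract_bijective hM' hfin
  exact ⟨Z, hP _ hZ, z, hz⟩

end Corepresentability

section Preservation

variable {A : Type u} [Category.{v} A] {B : Type u₁} [Category.{v} B] {E : Type u₂} [Category.{v} E]

lemma PreservesCoproducts.comp {F : A ⥤ B} {G : B ⥤ E} (hF : PreservesCoproducts F)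
    (hG : PreservesCoproducts G) : PreservesCoproducts (F ⋙ G) := fun J ↦ by
  have := hF J
  have := hG J
  infer_instance

lemma PreservesCoproducts.of_iso {F G : A ⥤ B} (hF : PreservesCoproducts F) (e : F ≅ G) :
    PreservesCoproducts G := fun J ↦ by
  have := hF J
  exact preservesColimitsOfShape_of_natIso e

lemma PreservesProducts.comp {F : A ⥤ B} {G : B ⥤ E} (hF : PreservesProducts F)
    (hG : PreservesProducts G) : PreservesProducts (F ⋙ G) := fun J ↦ by
  have := hF J
  have := hG J
  infer_instance

lemma PreservesProducts.of_iso {F G : A ⥤ B} (hF : PreservesProducts F) (e : F ≅ G) :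
    PreservesProducts G := fun J ↦ by
  have := hF J
  exact preservesLimitsOfShape_of_natIso e

variable {F : A ⥤ B} {G : B ⥤ A}

lemma preservesCoproducts_leftAdjoint (adj : F ⊣ G) : PreservesCoproducts F := fun J ↦ by
  have := adj.leftAdjoint_preservesColimits
  infer_instance

lemma preservesProducts_rightAdjoint (adj : F ⊣ G) : PreservesProducts G := fun J ↦ by
  have := adj.rightAdjoint_preservesLimits
  infer_instance

end Preservation

section TriangulatedFunctors

variable {T : Type u₁} [Category.{v} T] [HasZeroObject T] [Preadditive T] [HasShift T ℤ]
  [∀ n : ℤ, (shiftFunctor T n).Additive] [Pretriangulated T]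
  {T' : Type u₂} [Category.{v} T'] [HasZeroObject T'] [Preadditive T'] [HasShift T' ℤ]
  [∀ n : ℤ, (shiftFunctor T' n).Additive] [Pretriangulated T']

lemma exists_isTriangulated_rightAdjoint {A : T ⥤ T'} {B : T' ⥤ T} (adj : A ⊣ B) [A.CommShift ℤ]
    [A.IsTriangulated] : ∃ _ : B.CommShift ℤ, B.IsTriangulated :=
  letI := adj.rightAdjointCommShift ℤ
  have := adj.commShift_of_leftAdjoint ℤ
  ⟨_, adj.isTriangulated_rightAdjoint⟩

lemma IsCompactlyGenerated.isIso_app_of_isTriangulated (hT : IsCompactlyGenerated T)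
    (hT' : IsCompactlyGenerated T') {A B : T ⥤ T'} [A.CommShift ℤ] [B.CommShift ℤ]
    [A.IsTriangulated] [B.IsTriangulated] (hA : PreservesCoproducts A) (hB : PreservesCoproducts B)
    (τ : A ⟶ B) (h : ∀ t, IsCompactObj t → IsIso (τ.app t)) (X : T) : IsIso (τ.app X) := by
  refine hT'.isIso_of_bijective _ fun c hc ↦ ?_
  have := hT.isIso_app (hA.comp hc) (hB.comp hc)
    (Functor.whiskerRight τ (preadditiveCoyoneda.obj (op c))) (fun t ht ↦ by
      have := h t ht
      rw [Functor.whiskerRight_app]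
      infer_instance) X
  exact ConcreteCategory.bijective_of_isIso
    ((Functor.whiskerRight τ (preadditiveCoyoneda.obj (op c))).app X)

end TriangulatedFunctors

section Mates

variable {N : Type u₁} [Category.{v} N] {M : Type u₂} [Category.{v} M]

lemma isIso_homEquiv_of_adjunctions {Λ : N ⥤ M} {R : M ⥤ N} (adj : Λ ⊣ R) {E T : N ⥤ N}
    {E' T' : M ⥤ M} (a : E ⊣ T) (a' : E' ⊣ T') (σ : T ⋙ Λ ⟶ Λ ⋙ T') (σ' : E ⋙ Λ ≅ Λ ⋙ E')
    (h : ∀ n, Λ.map (a.unit.app n) ≫ σ.app (E.obj n) ≫ T'.map (σ'.hom.app n) =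
      a'.unit.app (Λ.obj n)) (m : M) :
    IsIso (adj.homEquiv (T.obj (R.obj m)) (T'.obj m)
      (σ.app (R.obj m) ≫ T'.map (adj.counit.app m))) := by
  refine isIso_of_yoneda_map_bijective _ fun n ↦ ?_
  let e : (n ⟶ T.obj (R.obj m)) ≃ (n ⟶ R.obj (T'.obj m)) :=
    (a.homEquiv _ _).symm.trans ((adj.homEquiv _ _).symm.trans
      ((σ'.app n).homFromEquiv.trans ((a'.homEquiv _ _).trans (adj.homEquiv _ _))))
  convert e.bijective using 1
  ext f
  have hσ (n) : Λ.map (a.unit.app n) ≫ σ.app (E.obj n) =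
      a'.unit.app (Λ.obj n) ≫ T'.map (σ'.inv.app n) := by
    rw [← h, Category.assoc, Category.assoc, ← T'.map_comp]
    simp
  have hnat := σ.naturality (a.homEquiv _ _ |>.symm f)
  rw [← adj.homEquiv_naturality_left]
  simp only [e, Equiv.trans_apply, Iso.homFromEquiv_apply]
  congr 1
  rw [a'.homEquiv_unit, Functor.map_comp, Iso.app_inv, ← reassoc_of% hσ n, adj.homEquiv_counit,
    T'.map_comp]
  dsimp at hnat ⊢
  rw [← reassoc_of% hnat, ← Λ.map_comp_assoc, ← a.homEquiv_unit, Equiv.apply_symm_apply]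

end Mates

section DualPairs

variable {C : Type u} [Category.{v} C] [MonoidalCategory C]

lemma tensorLeftAdjunction_unit_app (x y z : C) [ExactPairing x y] :
    (tensorLeftAdjunction x y).unit.app z = (λ_ z).inv ≫ η_ x y ▷ z ≫ (α_ _ _ _).hom := by
  simp [tensorLeftAdjunction, tensorLeftHomEquiv]

lemma tensorLeftAdjunction_counit_app (x y z : C) [ExactPairing x y] :
    (tensorLeftAdjunction x y).counit.app z = (α_ _ _ _).inv ≫ ε_ x y ▷ z ≫ (λ_ z).hom := by
  simp [tensorLeftAdjunction, tensorLeftHomEquiv]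

lemma whiskerLeft_zigzag_comp {x d : C} (e : x ⊗ d ⟶ 𝟙_ C) (η : 𝟙_ C ⟶ d ⊗ x)
    (h : x ◁ η ≫ (α_ _ _ _).inv ≫ e ▷ x = (ρ_ x).hom ≫ (λ_ x).inv) :
    x ◁ (η ▷ d ≫ (α_ _ _ _).hom ≫ d ◁ e ≫ (ρ_ d).hom) ≫ e = x ◁ (λ_ d).hom ≫ e :=
  calc
    _ = 𝟙 _ ⊗≫ x ◁ η ▷ d ⊗≫ ((x ⊗ d) ◁ e ≫ e ▷ 𝟙_ C) ⊗≫ 𝟙 _ := by monoidal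
    _ = 𝟙 _ ⊗≫ (x ◁ η ≫ (α_ x d x).inv ≫ e ▷ x) ▷ d ⊗≫ e ⊗≫ 𝟙 _ := by
      rw [whisker_exchange]
      monoidal
    _ = _ := by
      rw [h]
      monoidal

lemma comp_whiskerRight_zigzag {x z z' n : C} [ExactPairing z z'] (u : 𝟙_ C ⟶ z ⊗ n)
    (s : 𝟙_ C ⟶ x ⊗ z') :
    u ≫ ((λ_ z).inv ≫ (tensorRightHomEquiv (𝟙_ C) z z' x).symm s) ▷ n =
      s ≫ x ◁ ((ρ_ z').inv ≫ (tensorLeftHomEquiv (𝟙_ C) z z' n).symm u) := by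
  simp only [tensorRightHomEquiv, tensorLeftHomEquiv, Equiv.coe_fn_symm_mk]
  calc
    _ = 𝟙 _ ⊗≫ (𝟙_ C ◁ u ≫ s ▷ (z ⊗ n)) ⊗≫ x ◁ ε_ z z' ▷ n ⊗≫ 𝟙 _ := by monoidal
    _ = _ := by
      rw [whisker_exchange]
      monoidal

lemma bijective_comp_zigzag_of_corepresents {z z' n t t' : C} [ExactPairing z z']
    [ExactPairing t' t] {u : 𝟙_ C ⟶ z ⊗ n}
    (hu : ∀ y, Function.Bijective fun f : z ⟶ y ↦ u ≫ f ▷ n) :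
    Function.Bijective fun g : t ⟶ z' ↦
      g ≫ (ρ_ z').inv ≫ (tensorLeftHomEquiv (𝟙_ C) z z' n).symm u := by
  let A (w : C) : (t ⟶ w) ≃ (𝟙_ C ⟶ t' ⊗ w) :=
    (ρ_ t).symm.homFromEquiv.trans (tensorLeftHomEquiv (𝟙_ C) t' t w)
  have hA {w w' : C} (g : t ⟶ w) (k : w ⟶ w') : A w' (g ≫ k) = A w g ≫ t' ◁ k := by
    simp [A, tensorLeftHomEquiv]
  let B : (𝟙_ C ⟶ t' ⊗ z') ≃ (z ⟶ t') :=
    (tensorRightHomEquiv (𝟙_ C) z z' t').symm.trans (λ_ z).homFromEquiv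
  let e := (A z').trans (B.trans ((Equiv.ofBijective _ (hu t')).trans (A n).symm))
  convert e.bijective using 1
  ext g
  apply (A n).injective
  simp only [e, Equiv.trans_apply, Equiv.apply_symm_apply, Equiv.ofBijective_apply]
  rw [hA]
  exact (comp_whiskerRight_zigzag u (A _ g)).symm

lemma bijective_whiskerRight_comp_evaluation (w a d : C) [ExactPairing d a] :
    Function.Bijective fun k : w ⟶ a ↦ k ▷ d ≫ ε_ d a := by
  convert ((λ_ a).symm.homToEquiv.trans (tensorRightHomEquiv w d a (𝟙_ C)).symm).bijective using 1
  ext k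
  simp only [Iso.homToEquiv, tensorRightHomEquiv, Equiv.trans_apply, Equiv.coe_fn_mk,
    Equiv.coe_fn_symm_mk]
  dsimp
  monoidal

variable {D : Type u₁} [Category.{v} D] [MonoidalCategory D]

/-- The dual pair `(F x, F y)` obtained by applying a strong monoidal functor `F` to a dual pair
`(x, y)`. -/
abbrev mapExactPairing (F : D ⥤ C) [F.Monoidal] (x y : D) [ExactPairing x y] :
    ExactPairing (F.obj x) (F.obj y) where
  coevaluation' := Functor.LaxMonoidal.ε F ≫ F.map (η_ x y) ≫ Functor.OplaxMonoidal.δ F x y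
  evaluation' := Functor.LaxMonoidal.μ F y x ≫ F.map (ε_ x y) ≫ Functor.OplaxMonoidal.η F
  coevaluation_evaluation' := by
    have h := congrArg F.map (ExactPairing.coevaluation_evaluation (X := x) (Y := y))
    simp only [Functor.map_comp, Functor.Monoidal.map_whiskerLeft,
      Functor.Monoidal.map_associator_inv, Functor.Monoidal.map_whiskerRight,
      Functor.Monoidal.map_rightUnitor, Functor.Monoidal.map_leftUnitor_inv, Category.assoc,
      Functor.Monoidal.μ_δ_assoc, cancel_epi] at h
    rw [← cancel_epi (F.obj y ◁ Functor.OplaxMonoidal.η F),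
      ← cancel_mono (Functor.LaxMonoidal.ε F ▷ F.obj y),
      ← cancel_mono (Functor.LaxMonoidal.μ F _ _)]
    simp only [Category.assoc, comp_whiskerRight, MonoidalCategory.whiskerLeft_comp,
      Functor.Monoidal.whiskerLeft_η_ε_assoc, Functor.Monoidal.whiskerRight_η_ε_assoc]
    exact h
  evaluation_coevaluation' := by
    have h := congrArg F.map (ExactPairing.evaluation_coevaluation (X := x) (Y := y))
    simp only [Functor.map_comp, Functor.Monoidal.map_whiskerLeft,
      Functor.Monoidal.map_associator, Functor.Monoidal.map_whiskerRight,
      Functor.Monoidal.map_leftUnitor, Functor.Monoidal.map_rightUnitor_inv, Category.assoc,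
      Functor.Monoidal.μ_δ_assoc, cancel_epi] at h
    rw [← cancel_epi (Functor.OplaxMonoidal.η F ▷ F.obj x),
      ← cancel_mono (F.obj x ◁ Functor.LaxMonoidal.ε F),
      ← cancel_mono (Functor.LaxMonoidal.μ F _ _)]
    simp only [Category.assoc, comp_whiskerRight, MonoidalCategory.whiskerLeft_comp,
      Functor.Monoidal.whiskerLeft_η_ε_assoc, Functor.Monoidal.whiskerRight_η_ε_assoc]
    exact h

lemma map_tensorLeftAdjunction_unit_app (F : D ⥤ C) [F.Monoidal] (x y n : D) [ExactPairing x y] :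
    letI := mapExactPairing F x y
    F.map ((tensorLeftAdjunction x y).unit.app n) ≫ Functor.OplaxMonoidal.δ F x (y ⊗ n) ≫
      F.obj x ◁ Functor.OplaxMonoidal.δ F y n =
      (tensorLeftAdjunction (F.obj x) (F.obj y)).unit.app (F.obj n) := by
  let := mapExactPairing F x y
  have : η_ (F.obj x) (F.obj y) = Functor.LaxMonoidal.ε F ≫ F.map (η_ x y) ≫
    Functor.OplaxMonoidal.δ F x y := rfl
  rw [tensorLeftAdjunction_unit_app, tensorLeftAdjunction_unit_app, this]
  simp

end DualPairs

section Rigid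

variable {C : Type u} [Category.{v} C] [MonoidalCategory C] [MonoidalClosed C]

lemma whiskerLeft_rigidMap_ev (x y : C) :
    x ◁ rigidMap x y ≫ (ihom.ev x).app y =
      (α_ x ((ihom x).obj (𝟙_ C)) y).inv ≫ (ihom.ev x).app (𝟙_ C) ▷ y ≫ (λ_ y).hom := by
  rw [rigidMap, MonoidalClosed.whiskerLeft_curry_ihom_ev_app]

/-- The dual pair `([x, 𝟙], x)` of a rigid object `x`, with unit
`𝟙 ⟶ [x, x] ≅ [x, 𝟙] ⊗ x` and with the evaluation as counit. -/
abbrev IsRigidObj.dualExactPairing {x : C} (hx : IsRigidObj x) :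
    ExactPairing ((ihom x).obj (𝟙_ C)) x :=
  have := hx x
  let η : 𝟙_ C ⟶ (ihom x).obj (𝟙_ C) ⊗ x := MonoidalClosed.curry (ρ_ x).hom ≫ inv (rigidMap x x)
  have h₁ : x ◁ η ≫ (α_ _ _ _).inv ≫ (ihom.ev x).app (𝟙_ C) ▷ x = (ρ_ x).hom ≫ (λ_ x).inv := by
    rw [← cancel_mono (λ_ x).hom, Category.assoc, Category.assoc, ← whiskerLeft_rigidMap_ev,
      ← MonoidalCategory.whiskerLeft_comp_assoc]
    simp [η, MonoidalClosed.whiskerLeft_curry_ihom_ev_app]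
  { coevaluation' := η
    evaluation' := (ihom.ev x).app (𝟙_ C)
    coevaluation_evaluation' := h₁
    evaluation_coevaluation' := by
      rw [← cancel_mono (ρ_ _).hom]
      apply MonoidalClosed.uncurry_injective
      simp only [MonoidalClosed.uncurry_eq]
      simpa using whiskerLeft_zigzag_comp _ _ h₁ }

lemma isIso_curry_tensorLeftAdjunction_counit (x y z : C) [ExactPairing y x] :
    IsIso (MonoidalClosed.curry ((tensorLeftAdjunction y x).counit.app z)) := by
  have : MonoidalClosed.curry ((tensorLeftAdjunction y x).counit.app z) =
      ((tensorLeftAdjunction y x).rightAdjointUniq (ihom.adjunction x)).hom.app z := by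
    apply MonoidalClosed.uncurry_injective
    rw [MonoidalClosed.uncurry_curry, MonoidalClosed.uncurry_eq]
    exact (Adjunction.rightAdjointUniq_hom_app_counit _ (ihom.adjunction x) z).symm
  rw [this]
  infer_instance

lemma isIso_curry_evaluation (x y : C) [ExactPairing y x] :
    IsIso (MonoidalClosed.curry (ε_ y x)) := by
  have := isIso_curry_tensorLeftAdjunction_counit x y (𝟙_ C)
  have h : MonoidalClosed.curry (ε_ y x) =
      (ρ_ y).inv ≫ MonoidalClosed.curry ((tensorLeftAdjunction y x).counit.app (𝟙_ C)) := by
    rw [← MonoidalClosed.curry_natural_left, tensorLeftAdjunction_counit_app]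
    congr 1
    monoidal
  rw [h]
  infer_instance

lemma curry_evaluation_comp_rigidMap (x y z : C) [ExactPairing y x] :
    MonoidalClosed.curry (ε_ y x) ▷ z ≫ rigidMap x z =
      MonoidalClosed.curry ((tensorLeftAdjunction y x).counit.app z) := by
  rw [rigidMap, ← MonoidalClosed.curry_natural_left, tensorLeftAdjunction_counit_app]
  congr 1
  rw [associator_inv_naturality_middle_assoc, ← comp_whiskerRight_assoc,
    MonoidalClosed.whiskerLeft_curry_ihom_ev_app]

lemma isRigidObj_of_exactPairing (x y : C) [ExactPairing y x] : IsRigidObj x := fun z ↦ by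
  have := isIso_curry_evaluation x y
  have := isIso_curry_tensorLeftAdjunction_counit x y z
  rw [← curry_evaluation_comp_rigidMap] at this
  exact IsIso.of_isIso_comp_left (MonoidalClosed.curry (ε_ y x) ▷ z) _

lemma isRigidObj_unit : IsRigidObj (𝟙_ C) := isRigidObj_of_exactPairing _ (𝟙_ C)

lemma IsRigidObj.map {D : Type u₁} [Category.{v} D] [MonoidalCategory D] [MonoidalClosed D]
    (F : D ⥤ C) [F.Monoidal] {x : D} (hx : IsRigidObj x) : IsRigidObj (F.obj x) :=
  letI := hx.dualExactPairing
  letI := mapExactPairing F ((ihom x).obj (𝟙_ D)) x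
  isRigidObj_of_exactPairing _ (F.obj ((ihom x).obj (𝟙_ D)))

variable [BraidedCategory C]

/-- The dual pair `(x, [x, 𝟙])` of a rigid object `x` of a braided category. -/
abbrev IsRigidObj.exactPairing {x : C} (hx : IsRigidObj x) :
    ExactPairing x ((ihom x).obj (𝟙_ C)) :=
  letI := hx.dualExactPairing
  BraidedCategory.exactPairing_swap _ _

lemma IsRigidObj.dual {x : C} (hx : IsRigidObj x) : IsRigidObj ((ihom x).obj (𝟙_ C)) :=
  letI := hx.exactPairing
  isRigidObj_of_exactPairing _ x

end Rigid

section Pairings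

variable {C : Type u} [Category.{v} C] [MonoidalCategory C] [SymmetricCategory C]

lemma swapIso_naturality_left {a a' : C} (f : a ⟶ a') (b c : C) :
    f ▷ (b ⊗ c) ≫ (swapIso a' b c).hom = (swapIso a b c).hom ≫ b ◁ f ▷ c := by
  simp only [swapIso, Iso.trans_hom, Iso.symm_hom, whiskerRightIso_hom, Category.assoc]
  rw [associator_inv_naturality_left_assoc, ← comp_whiskerRight_assoc,
    BraidedCategory.braiding_naturality_left, comp_whiskerRight_assoc, associator_naturality_middle]

lemma swapIso_naturality_right (a b : C) {c c' : C} (f : c ⟶ c') :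
    a ◁ b ◁ f ≫ (swapIso a b c').hom = (swapIso a b c).hom ≫ b ◁ a ◁ f := by
  simp only [swapIso, Iso.trans_hom, Iso.symm_hom, whiskerRightIso_hom, Category.assoc]
  rw [associator_inv_naturality_right_assoc, whisker_exchange_assoc, associator_naturality_right]

lemma map_swapIso_δ {D : Type u₁} [Category.{v} D] [MonoidalCategory D] [SymmetricCategory D]
    (F : D ⥤ C) [F.Braided] (x y z : D) :
    F.map (swapIso x y z).hom ≫ Functor.OplaxMonoidal.δ F _ _ ≫
      F.obj y ◁ Functor.OplaxMonoidal.δ F x z =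
    Functor.OplaxMonoidal.δ F _ _ ≫ F.obj x ◁ Functor.OplaxMonoidal.δ F y z ≫
      (swapIso (F.obj x) (F.obj y) (F.obj z)).hom := by
  simp only [swapIso, Iso.trans_hom, Iso.symm_hom, whiskerRightIso_hom, F.map_comp, Category.assoc]
  rw [← Functor.OplaxMonoidal.associativity, ← Functor.OplaxMonoidal.δ_natural_left_assoc,
    ← comp_whiskerRight_assoc, F.map_braiding, reassoc_of% Functor.OplaxMonoidal.associativity_inv]
  simp

/-- The map `a ⟶ z` corresponding to `𝟙 ⟶ z ⊗ d` under a pairing `p` of `a` and `d`. The pairing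
need not be perfect; if it is the counit of a dual pair, then this is the usual bijection
`Hom(𝟙, z ⊗ d) ≃ Hom(a, z)`. -/
def pairMap {a d : C} (p : a ⊗ d ⟶ 𝟙_ C) {z : C} (s : 𝟙_ C ⟶ z ⊗ d) : a ⟶ z :=
  (ρ_ a).inv ≫ a ◁ s ≫ (swapIso a z d).hom ≫ z ◁ p ≫ (ρ_ z).hom

lemma pairMap_whiskerRight_comp {a a' d : C} (f : a ⟶ a') (p : a' ⊗ d ⟶ 𝟙_ C) {z : C}
    (s : 𝟙_ C ⟶ z ⊗ d) : pairMap (f ▷ d ≫ p) s = f ≫ pairMap p s := by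
  simp only [pairMap]
  rw [MonoidalCategory.whiskerLeft_comp, Category.assoc, ← reassoc_of% swapIso_naturality_left,
    whisker_exchange_assoc, rightUnitor_inv_naturality_assoc]

lemma bijective_pairMap (a d z : C) [ExactPairing d a] :
    Function.Bijective fun s : 𝟙_ C ⟶ z ⊗ d ↦ pairMap (ε_ d a) s := by
  let := BraidedCategory.exactPairing_swap d a
  convert ((tensorRightHomEquiv (𝟙_ C) a d z).symm.trans (λ_ a).homFromEquiv).bijective using 1
  ext s
  have hs : s ▷ a = (β_ _ _).hom ≫ a ◁ s ≫ (β_ _ _).hom := by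
    rw [BraidedCategory.braiding_naturality_right, SymmetricCategory.symmetry_assoc]
  have hε : ε_ a d = (β_ _ _).hom ≫ ε_ d a := rfl
  have hβ : z ◁ (β_ a d).hom ≫ z ◁ (β_ d a).hom = 𝟙 _ := by
    rw [← MonoidalCategory.whiskerLeft_comp, SymmetricCategory.symmetry,
      MonoidalCategory.whiskerLeft_id]
  simp [pairMap, tensorRightHomEquiv, hs, hε, swapIso, -BraidedCategory.braiding_tensor_right_hom,
    BraidedCategory.braiding_tensor_right_hom, reassoc_of% hβ]

lemma whiskerLeft_pairMap (w : C) {a d z : C} (p : a ⊗ d ⟶ 𝟙_ C) (s : 𝟙_ C ⟶ z ⊗ d) :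
    w ◁ pairMap p s ≫ (β_ w z).hom = (ρ_ (w ⊗ a)).inv ≫ (w ⊗ a) ◁ s ≫
      (swapIso (w ⊗ a) z d).hom ≫ z ◁ ((α_ _ _ _).hom ≫ w ◁ p ≫ (ρ_ w).hom) := by
  simp only [pairMap, swapIso, BraidedCategory.braiding_tensor_left_hom, Iso.trans_hom,
    Iso.symm_hom, whiskerRightIso_hom]
  calc
    _ = 𝟙 _ ⊗≫ w ◁ a ◁ s ⊗≫ w ◁ (β_ a z).hom ▷ d ⊗≫
        ((w ⊗ z) ◁ p ≫ (β_ w z).hom ▷ 𝟙_ C) ⊗≫ 𝟙 _ := by monoidal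
    _ = _ := by
      rw [whisker_exchange]
      monoidal

end Pairings

section ProjectionFormula

variable {C : Type u₁} [Category.{v} C] [MonoidalCategory C] [SymmetricCategory C]
  {D : Type u₂} [Category.{v} D] [MonoidalCategory D] [SymmetricCategory D]
  {F : D ⥤ C} [F.Braided] {G : C ⥤ D} (adj₁ : F ⊣ G)

lemma map_projMap_counit (x : D) (y : C) :
    F.map (projMap adj₁ x y) ≫ adj₁.counit.app _ =
      Functor.OplaxMonoidal.δ F x (G.obj y) ≫ F.obj x ◁ adj₁.counit.app y :=
  (adj₁.homEquiv_counit ..).symm.trans (Equiv.symm_apply_apply _ _)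

lemma projMap_naturality_left {x x' : D} (f : x ⟶ x') (y : C) :
    f ▷ G.obj y ≫ projMap adj₁ x' y = projMap adj₁ x y ≫ G.map (F.map f ▷ y) := by
  rw [projMap, projMap, ← adj₁.homEquiv_naturality_left, ← adj₁.homEquiv_naturality_right]
  simp [whisker_exchange]

lemma projMap_naturality_right (x : D) {y y' : C} (f : y ⟶ y') :
    x ◁ G.map f ≫ projMap adj₁ x y' = projMap adj₁ x y ≫ G.map (F.obj x ◁ f) := by
  rw [projMap, projMap, ← adj₁.homEquiv_naturality_left, ← adj₁.homEquiv_naturality_right]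
  rw [← Functor.OplaxMonoidal.δ_natural_right_assoc, Category.assoc,
    ← MonoidalCategory.whiskerLeft_comp, ← MonoidalCategory.whiskerLeft_comp,
    adj₁.counit_naturality]

/-- The projection formula, from the invertibility of the projection maps. -/
def projIso (h : ∀ x y, IsIso (projMap adj₁ x y)) : ProjIso F G :=
  NatIso.ofComponents
    (fun x ↦ NatIso.ofComponents (fun y ↦ @asIso _ _ _ _ _ (h x y))
      (projMap_naturality_right adj₁ x)) fun f ↦ by
    ext y
    exact projMap_naturality_left adj₁ f y

lemma isIso_projMap_of_exactPairing (x x' : D) [ExactPairing x x'] (y : C) :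
    IsIso (projMap adj₁ x y) := by
  let := mapExactPairing F x x'
  exact isIso_homEquiv_of_adjunctions adj₁ (tensorLeftAdjunction x x')
    (tensorLeftAdjunction (F.obj x) (F.obj x')) (Functor.Monoidal.commTensorLeft F x).inv
    (Functor.Monoidal.commTensorLeft F _).symm
    (fun n ↦ map_tensorLeftAdjunction_unit_app F _ _ n) y

lemma tensorLeftAdjunction_unit_comp_projMap (x x' : D) [ExactPairing x x'] (y : C) :
    letI := mapExactPairing F x x'
    (tensorLeftAdjunction x x').unit.app (G.obj y) ≫ x ◁ projMap adj₁ x' y ≫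
      projMap adj₁ x (F.obj x' ⊗ y) =
        G.map ((tensorLeftAdjunction (F.obj x) (F.obj x')).unit.app y) := by
  let := mapExactPairing F x x'
  apply (adj₁.homEquiv _ _).symm.injective
  have hunit := map_tensorLeftAdjunction_unit_app F x x' (G.obj y)
  have hnat := (tensorLeftAdjunction (F.obj x) (F.obj x')).unit.naturality (adj₁.counit.app y)
  rw [adj₁.homEquiv_counit, adj₁.homEquiv_counit, adj₁.counit_naturality, F.map_comp, F.map_comp,
    Category.assoc, Category.assoc, map_projMap_counit,
    ← Functor.OplaxMonoidal.δ_natural_right_assoc, ← MonoidalCategory.whiskerLeft_comp,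
    map_projMap_counit, MonoidalCategory.whiskerLeft_comp]
  exact ((reassoc_of% hunit) _).trans hnat.symm

lemma projMap_swapIso (x y : D) (z : C) :
    x ◁ projMap adj₁ y z ≫ projMap adj₁ x (F.obj y ⊗ z) ≫
      G.map (swapIso (F.obj x) (F.obj y) z).hom =
    (swapIso x y (G.obj z)).hom ≫ y ◁ projMap adj₁ x z ≫ projMap adj₁ y (F.obj x ⊗ z) := by
  apply (adj₁.homEquiv _ _).symm.injective
  rw [adj₁.homEquiv_counit, adj₁.homEquiv_counit]
  simp only [F.map_comp, Category.assoc]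
  rw [map_projMap_counit, adj₁.counit_naturality, reassoc_of% map_projMap_counit,
    ← Functor.OplaxMonoidal.δ_natural_right_assoc, ← Functor.OplaxMonoidal.δ_natural_right_assoc,
    ← MonoidalCategory.whiskerLeft_comp_assoc, ← MonoidalCategory.whiskerLeft_comp,
    map_projMap_counit, map_projMap_counit, MonoidalCategory.whiskerLeft_comp_assoc,
    MonoidalCategory.whiskerLeft_comp]
  dsimp only [Functor.id_obj]
  rw [swapIso_naturality_right, reassoc_of% map_swapIso_δ]

lemma whiskerLeft_homEquiv_projMap (b z : C) (r : 𝟙_ C ⟶ z) :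
    (ρ_ (G.obj b)).inv ≫ G.obj b ◁ adj₁.homEquiv _ _ (Functor.OplaxMonoidal.η F ≫ r) ≫
      projMap adj₁ (G.obj b) z ≫ G.map (adj₁.counit.app b ▷ z) =
    G.map ((ρ_ b).inv ≫ b ◁ r) := by
  apply (adj₁.homEquiv _ _).symm.injective
  rw [adj₁.homEquiv_counit, adj₁.homEquiv_counit]
  simp only [F.map_comp, Category.assoc]
  rw [adj₁.counit_naturality, reassoc_of% map_projMap_counit,
    ← Functor.OplaxMonoidal.δ_natural_right_assoc,
    ← MonoidalCategory.whiskerLeft_comp_assoc, ← adj₁.homEquiv_counit, Equiv.symm_apply_apply]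
  dsimp only [Functor.id_obj]
  rw [adj₁.counit_naturality, MonoidalCategory.whiskerLeft_comp_assoc, whisker_exchange]
  simp

variable {adj₁} {π : ProjIso F G} (hπ : ∀ x y, (π.hom.app x).app y = projMap adj₁ x y)

include hπ

lemma projMap_comp_inv (x : D) (y : C) : projMap adj₁ x y ≫ (π.inv.app x).app y = 𝟙 _ := by
  rw [← hπ]
  exact congr_app (π.hom_inv_id_app x) y

lemma inv_comp_projMap (x : D) (y : C) : (π.inv.app x).app y ≫ projMap adj₁ x y = 𝟙 _ := by
  rw [← hπ]
  exact congr_app (π.inv_hom_id_app x) y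

lemma whiskerLeft_inv_swapIso_projMap (x y : D) (z : C) :
    x ◁ (π.inv.app y).app z ≫ (swapIso x y (G.obj z)).hom ≫ y ◁ projMap adj₁ x z =
      projMap adj₁ x (F.obj y ⊗ z) ≫ G.map (swapIso (F.obj x) (F.obj y) z).hom ≫
        (π.inv.app y).app (F.obj x ⊗ z) := by
  have : IsIso (projMap adj₁ y (F.obj x ⊗ z)) :=
    ⟨_, projMap_comp_inv hπ _ _, inv_comp_projMap hπ _ _⟩
  rw [← cancel_mono (projMap adj₁ y (F.obj x ⊗ z))]
  simp only [Category.assoc]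
  rw [← projMap_swapIso, ← MonoidalCategory.whiskerLeft_comp_assoc, inv_comp_projMap hπ]
  have h := inv_comp_projMap hπ y (F.obj x ⊗ z)
  dsimp at h ⊢
  simp [h]

end ProjectionFormula

section GrothendieckMaps

variable {C : Type u₁} [Category.{v} C] [MonoidalCategory C] [SymmetricCategory C]
  {D : Type u₂} [Category.{v} D] [MonoidalCategory D] [SymmetricCategory D]
  {F : D ⥤ C} {G : C ⥤ D} {H : D ⥤ C}

/-- The comparison map `f^* x ⊗ f^{(1)} y ⟶ f^{(1)} (x ⊗ y)`: the map `genGrothMap` with the factors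
exchanged on both sides. In this order it is a mate of the projection formula. -/
def swappedGenGrothMap (π : ProjIso F G) (adj₂ : G ⊣ H) (x y : D) :
    F.obj x ⊗ H.obj y ⟶ H.obj (x ⊗ y) :=
  adj₂.homEquiv _ _ ((π.inv.app x).app (H.obj y) ≫ x ◁ adj₂.counit.app y)

lemma genGrothMap_eq (π : ProjIso F G) (adj₂ : G ⊣ H) (x y : D) :
    genGrothMap π adj₂ x y =
      (β_ _ _).hom ≫ swappedGenGrothMap π adj₂ y x ≫ H.map (β_ _ _).hom := by
  rw [genGrothMap, swappedGenGrothMap, ← adj₂.homEquiv_naturality_right,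
    ← adj₂.homEquiv_naturality_left]
  simp

lemma isIso_swappedGenGrothMap_of_exactPairing [F.Braided] {adj₁ : F ⊣ G} {π : ProjIso F G}
    (hπ : ∀ x y, (π.hom.app x).app y = projMap adj₁ x y) (adj₂ : G ⊣ H) (x x' : D)
    [ExactPairing x x'] (y : D) : IsIso (swappedGenGrothMap π adj₂ x y) := by
  let := mapExactPairing F x x'
  refine isIso_homEquiv_of_adjunctions adj₂ (tensorLeftAdjunction (F.obj x) (F.obj x'))
    (tensorLeftAdjunction x x') (π.inv.app x) (π.symm.app x') (fun n ↦ ?_) y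
  have h (x y) := projMap_comp_inv hπ x y
  rw [← tensorLeftAdjunction_unit_comp_projMap adj₁ x x' n]
  dsimp at h ⊢
  rw [Category.assoc, Category.assoc, reassoc_of% h, ← MonoidalCategory.whiskerLeft_comp, h]
  simp

lemma isIso_genGrothMap_of_exactPairing [F.Braided] {adj₁ : F ⊣ G} {π : ProjIso F G}
    (hπ : ∀ x y, (π.hom.app x).app y = projMap adj₁ x y) (adj₂ : G ⊣ H) (x y y' : D)
    [ExactPairing y y'] : IsIso (genGrothMap π adj₂ x y) := by
  have := isIso_swappedGenGrothMap_of_exactPairing hπ adj₂ y y' x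
  rw [genGrothMap_eq]
  infer_instance

variable (π : ProjIso F G) (adj₂ : G ⊣ H)

lemma genGrothMap_naturality_left {x x' : D} (f : x ⟶ x') (y : D) :
    H.map f ▷ F.obj y ≫ genGrothMap π adj₂ x' y = genGrothMap π adj₂ x y ≫ H.map (f ▷ y) := by
  rw [genGrothMap, genGrothMap, ← adj₂.homEquiv_naturality_left, ← adj₂.homEquiv_naturality_right]
  have h := (π.inv.app y).naturality (H.map f)
  dsimp at h
  congr 1
  rw [← G.map_comp_assoc, BraidedCategory.braiding_naturality_left, G.map_comp_assoc,
    reassoc_of% h, BraidedCategory.braiding_naturality_right_assoc]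
  simp [← comp_whiskerRight]

lemma genGrothMap_naturality_right (x : D) {y y' : D} (f : y ⟶ y') :
    H.obj x ◁ F.map f ≫ genGrothMap π adj₂ x y' = genGrothMap π adj₂ x y ≫ H.map (x ◁ f) := by
  rw [genGrothMap, genGrothMap, ← adj₂.homEquiv_naturality_left, ← adj₂.homEquiv_naturality_right]
  have h := congr_app (π.inv.naturality f) (H.obj x)
  dsimp at h
  congr 1
  rw [← G.map_comp_assoc, BraidedCategory.braiding_naturality_right, G.map_comp_assoc,
    reassoc_of% h, BraidedCategory.braiding_naturality_left_assoc, whisker_exchange]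
  simp

lemma grothMap_naturality {y y' : D} (f : y ⟶ y') :
    dualizingObj H ◁ F.map f ≫ grothMap π adj₂ y' = grothMap π adj₂ y ≫ H.map f := by
  simp only [grothMap, Category.assoc]
  rw [reassoc_of% genGrothMap_naturality_right, ← H.map_comp, ← H.map_comp, leftUnitor_naturality]

/-- The Grothendieck duality maps `ω ⊗ f^* y ⟶ f^{(1)} y`, as a natural transformation. -/
def grothNat : F ⋙ tensorLeft (dualizingObj H) ⟶ H where
  app y := grothMap π adj₂ y
  naturality _ _ f := grothMap_naturality π adj₂ f

lemma isIso_grothNat (h : ∀ y, IsIso (genGrothMap π adj₂ (𝟙_ D) y)) : IsIso (grothNat π adj₂) := by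
  rw [NatTrans.isIso_iff_isIso_app]
  intro y
  have := h y
  dsimp only [grothNat, grothMap]
  infer_instance

/-- The trace `f_* (ω ⊗ f^* y) ⟶ y`, adjoint to the Grothendieck duality map
`ω ⊗ f^* y ⟶ f^{(1)} y`. -/
def grothTrace (y : D) : G.obj (dualizingObj H ⊗ F.obj y) ⟶ y :=
  G.map (β_ _ _).hom ≫ (π.inv.app y).app (dualizingObj H) ≫ y ◁ adj₂.counit.app (𝟙_ D) ≫ (ρ_ y).hom

lemma grothMap_eq (y : D) : grothMap π adj₂ y = adj₂.homEquiv _ _ (grothTrace π adj₂ y) := by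
  rw [grothMap, genGrothMap, ← adj₂.homEquiv_naturality_right]
  congr 1
  simp only [grothTrace, Category.assoc]
  rw [← BraidedCategory.braiding_naturality_right_assoc]
  simp

end GrothendieckMaps

section TracePairing

variable {C : Type u₁} [Category.{v} C] [MonoidalCategory C] [SymmetricCategory C]
  {D : Type u₂} [Category.{v} D] [MonoidalCategory D] [SymmetricCategory D]
  {F : D ⥤ C} [F.Braided] {G : C ⥤ D} {H : D ⥤ C}

/-- The pairing of `f_* (ω ⊗ c)` and `f_* c'` induced by a pairing of `c` and `c'`, with values in
`f_* ω` and then, through the counit of `f_* ⊣ f^{(1)}`, in `𝟙`. -/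
def pushPairing (adj₁ : F ⊣ G) (adj₂ : G ⊣ H) {c c' : C} (p : c ⊗ c' ⟶ 𝟙_ C) :
    G.obj (dualizingObj H ⊗ c) ⊗ G.obj c' ⟶ 𝟙_ D :=
  projMap adj₁ _ c' ≫ G.map (adj₁.counit.app _ ▷ c') ≫
    G.map ((α_ _ _ _).hom ≫ dualizingObj H ◁ p ≫ (ρ_ _).hom) ≫ adj₂.counit.app (𝟙_ D)

variable {adj₁ : F ⊣ G} {π : ProjIso F G} (hπ : ∀ x y, (π.hom.app x).app y = projMap adj₁ x y)
  (adj₂ : G ⊣ H)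

include hπ

lemma pairMap_pushPairing {c c' : C} (p : c ⊗ c' ⟶ 𝟙_ C) {y : D} (s : 𝟙_ C ⟶ F.obj y ⊗ c') :
    pairMap (pushPairing adj₁ adj₂ p)
      (adj₁.homEquiv _ _ (Functor.OplaxMonoidal.η F ≫ s) ≫ (π.inv.app y).app c') =
        G.map (dualizingObj H ◁ pairMap p s) ≫ grothTrace π adj₂ y := by
  have hnat := (π.inv.app y).naturality
  have hproj := whiskerLeft_homEquiv_projMap adj₁ (dualizingObj H ⊗ c) _ s
  have hswap := swapIso_naturality_left (adj₁.counit.app (dualizingObj H ⊗ c)) (F.obj y) c'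
  have hinv := whiskerLeft_inv_swapIso_projMap hπ (G.obj (dualizingObj H ⊗ c)) y c'
  dsimp at hnat
  dsimp only [Functor.id_obj, Functor.comp_obj] at hproj hswap
  rw [grothTrace, ← G.map_comp_assoc, whiskerLeft_pairMap, pairMap, pushPairing]
  simp only [MonoidalCategory.whiskerLeft_comp, Category.assoc]
  rw [reassoc_of% hinv, ← reassoc_of% hnat, ← reassoc_of% hnat,
    ← G.map_comp_assoc (swapIso _ _ _).hom, ← hswap, G.map_comp_assoc, reassoc_of% hproj]
  simp

variable (c c' : C) [ExactPairing c' c]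

lemma bijective_whiskerRight_comp_pushPairing (w : D) :
    Function.Bijective fun k : w ⟶ G.obj (dualizingObj H ⊗ c) ↦
      k ▷ G.obj c' ≫ pushPairing adj₁ adj₂ (ε_ c' c) := by
  let e : (w ⟶ G.obj (dualizingObj H ⊗ c)) ≃ (w ⊗ G.obj c' ⟶ 𝟙_ D) :=
    (adj₁.homEquiv _ _).symm.trans
      ((tensorRightHomEquiv (F.obj w) c' c (dualizingObj H)).symm.trans
        ((adj₂.homEquiv _ _).symm.trans ((π.app w).app c').symm.homFromEquiv))
  convert e.bijective using 1
  ext k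
  simp only [e, Equiv.trans_apply, Iso.homFromEquiv_apply, tensorRightHomEquiv,
    Equiv.coe_fn_symm_mk, pushPairing, adj₁.homEquiv_counit, adj₂.homEquiv_counit]
  rw [reassoc_of% projMap_naturality_left, ← hπ]
  simp

lemma bijective_pairMap_pushPairing (d' : D) [ExactPairing (G.obj c') d'] (y : D) :
    Function.Bijective fun s : 𝟙_ D ⟶ y ⊗ G.obj c' ↦
      pairMap (pushPairing adj₁ adj₂ (ε_ c' c)) s := by
  have hev (w : D) := bijective_whiskerRight_comp_evaluation w d' (G.obj c')
  have hpush := bijective_whiskerRight_comp_pushPairing hπ adj₂ c c'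
  obtain ⟨ξ, hξ⟩ := (hev _).2 (pushPairing adj₁ adj₂ (ε_ c' c))
  have : IsIso ξ := by
    refine isIso_of_yoneda_map_bijective _ fun w ↦ ?_
    rw [← Function.Bijective.of_comp_iff' (hev w)]
    convert hpush w using 1
    ext k
    simp [← hξ]
  simp only [← hξ, pairMap_whiskerRight_comp]
  exact (asIso ξ).symm.homFromEquiv.bijective.comp (bijective_pairMap _ _ y)

lemma bijective_map_comp_grothTrace (d' : D) [ExactPairing (G.obj c') d'] (y : D) :
    Function.Bijective fun g : c ⟶ F.obj y ↦
      G.map (dualizingObj H ◁ g) ≫ grothTrace π adj₂ y := by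
  rw [← Function.Bijective.of_comp_iff _ (bijective_pairMap c c' (F.obj y))]
  let e : (𝟙_ C ⟶ F.obj y ⊗ c') ≃ (𝟙_ D ⟶ y ⊗ G.obj c') :=
    (Functor.Monoidal.εIso F).homFromEquiv.trans ((adj₁.homEquiv _ _).trans
      ((π.app y).app c').symm.homToEquiv)
  convert (bijective_pairMap_pushPairing hπ adj₂ c c' d' y).comp e.bijective using 1
  ext s
  exact (pairMap_pushPairing hπ adj₂ (ε_ c' c) s).symm

end TracePairing

section WirthmullerMaps

variable {C : Type u₁} [Category.{v} C] [MonoidalCategory C] [SymmetricCategory C]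
  {D : Type u₂} [Category.{v} D] [MonoidalCategory D]
  {F : D ⥤ C} {G : C ⥤ D} {H : D ⥤ C} {L : C ⥤ D}
  (π : ProjIso F G) (adj₀ : L ⊣ F) (adj₂ : G ⊣ H)

lemma urWirthMap_comp_counit (y : D) :
    urWirthMap π adj₀ adj₂ (F.obj y) ≫ adj₀.counit.app y = grothTrace π adj₂ y := by
  have h := congr_app (π.inv.naturality (adj₀.counit.app y)) (dualizingObj H)
  dsimp at h
  simp only [urWirthMap, grothTrace, Category.assoc]
  rw [← rightUnitor_naturality]
  dsimp only [Functor.id_obj]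
  rw [whisker_exchange_assoc, ← reassoc_of% h, ← G.map_comp_assoc,
    ← G.map_comp_assoc, Category.assoc, ← comp_whiskerRight, adj₀.right_triangle_components]
  simp

/-- The ur-Wirthmüller maps `f_* (ω ⊗ x) ⟶ f_{(1)} x`, as a natural transformation. -/
def urWirthNat : tensorLeft (dualizingObj H) ⋙ G ⟶ L where
  app x := urWirthMap π adj₀ adj₂ x
  naturality x x' f := by
    have h := congr_app (π.inv.naturality (L.map f)) (dualizingObj H)
    have hunit := adj₀.unit.naturality f
    dsimp at h hunit ⊢
    simp only [urWirthMap, Category.assoc]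
    rw [← rightUnitor_naturality]
    dsimp only [Functor.id_obj]
    rw [whisker_exchange_assoc, ← reassoc_of% h, ← G.map_comp_assoc,
      BraidedCategory.braiding_naturality_right, G.map_comp_assoc,
      ← G.map_comp_assoc (f ▷ _), ← comp_whiskerRight, hunit, comp_whiskerRight, G.map_comp_assoc]

variable [MonoidalClosed C] [SymmetricCategory D]

/-- The natural transformation `f^* ⟶ [ω, f^{(1)} -]` adjoint to Grothendieck duality. Unlike the
ur-Wirthmüller maps, to which it is conjugate, it does not involve a left adjoint of `f^*`. -/
def coWirthNat : F ⟶ H ⋙ ihom (dualizingObj H) where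
  app y := MonoidalClosed.curry (grothMap π adj₂ y)
  naturality y y' f := by
    dsimp
    rw [← MonoidalClosed.curry_natural_left, grothMap_naturality,
      MonoidalClosed.curry_natural_right]

lemma conjugateEquiv_urWirthNat :
    conjugateEquiv adj₀ ((ihom.adjunction (dualizingObj H)).comp adj₂) (urWirthNat π adj₀ adj₂) =
      coWirthNat π adj₂ := by
  ext y
  rw [conjugateEquiv_apply_app]
  simp only [coWirthNat, grothMap_eq, ← urWirthMap_comp_counit π adj₀]
  simp [MonoidalClosed.curry_eq, adj₂.homEquiv_unit, urWirthNat]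

lemma isIso_urWirthNat [IsIso (coWirthNat π adj₂)] : IsIso (urWirthNat π adj₀ adj₂) := by
  have : IsIso (conjugateEquiv adj₀ ((ihom.adjunction (dualizingObj H)).comp adj₂)
      (urWirthNat π adj₀ adj₂)) := by
    rw [conjugateEquiv_urWirthNat]
    infer_instance
  exact conjugateEquiv_of_iso adj₀ ((ihom.adjunction (dualizingObj H)).comp adj₂) _

end WirthmullerMaps

section TensorTriangulated

variable {C : Type u} [Category.{v} C] [HasZeroObject C] [Preadditive C] [HasShift C ℤ]
  [∀ n : ℤ, (shiftFunctor C n).Additive] [Pretriangulated C] [IsTriangulated C]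
  [MonoidalCategory C] [SymmetricCategory C] [MonoidalClosed C]
  [MonoidalPreadditive C] [(curriedTensor C).CommShift₂Int] [TensorTriangulated C]

instance (x : C) : (tensorLeft x).IsTriangulated := TensorTriangulated.tensorLeft_isTriangulated x

instance (x : C) : (tensorRight x).IsTriangulated :=
  TensorTriangulated.tensorRight_isTriangulated x

end TensorTriangulated

section RigidlyCompactlyGenerated

variable {C : Type u₁} [Category.{v} C] [Preadditive C] [MonoidalCategory C] [MonoidalClosed C]
  {D : Type u₂} [Category.{v} D] [Preadditive D] [MonoidalCategory D] [MonoidalClosed D]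

lemma IsCompactObj.map (hC : IsRigidlyCompactlyGenerated C) (hD : IsRigidlyCompactlyGenerated D)
    (F : D ⥤ C) [F.Monoidal] {x : D} (hx : IsCompactObj x) : IsCompactObj (F.obj x) :=
  (hC.2 _).2 (((hD.2 _).1 hx).map F)

end RigidlyCompactlyGenerated

section Corepresentation

variable {C : Type u} [Category.{v} C] [HasZeroObject C] [Preadditive C] [HasShift C ℤ]
  [∀ n : ℤ, (shiftFunctor C n).Additive] [Pretriangulated C]
  [MonoidalCategory C] [SymmetricCategory C] [MonoidalClosed C]

lemma IsRigidlyCompactlyGenerated.isCompactObj_of_corepresents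
    (hC : IsRigidlyCompactlyGenerated C) {n z : C} (hz : IsCompactObj z) {u : 𝟙_ C ⟶ z ⊗ n}
    (hu : ∀ y, Function.Bijective fun f : z ⟶ y ↦ u ≫ f ▷ n) : IsCompactObj n := by
  have hz' := (hC.2 z).1 hz
  let := hz'.exactPairing
  let φ := (ρ_ _).inv ≫ (tensorLeftHomEquiv (𝟙_ C) z ((ihom z).obj (𝟙_ C)) n).symm u
  have : IsIso φ := hC.1.isIso_of_bijective _ fun t ht ↦
    letI := ((hC.2 t).1 ht).dualExactPairing
    bijective_comp_zigzag_of_corepresents (t' := (ihom t).obj (𝟙_ C)) hu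
  have := hC.1.1
  exact ((hC.2 _).2 hz'.dual).of_iso (asIso φ)

end Corepresentation

section Adjoints

variable {C : Type u₁} [Category.{v} C] [HasZeroObject C] [Preadditive C] [HasShift C ℤ]
  [∀ n : ℤ, (shiftFunctor C n).Additive] [Pretriangulated C]
  [MonoidalCategory C] [MonoidalClosed C]
  {D : Type u₂} [Category.{v} D] [HasZeroObject D] [Preadditive D] [HasShift D ℤ]
  [∀ n : ℤ, (shiftFunctor D n).Additive] [Pretriangulated D]
  [MonoidalCategory D] [MonoidalClosed D]
  (hC : IsRigidlyCompactlyGenerated C) (hD : IsRigidlyCompactlyGenerated D)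
  {F : D ⥤ C} [F.Monoidal] [F.CommShift ℤ] [F.IsTriangulated]

include hC hD

lemma preservesCoproducts_rightAdjoint {G : C ⥤ D} (adj₁ : F ⊣ G) : PreservesCoproducts G := by
  obtain ⟨_, _⟩ := exists_isTriangulated_rightAdjoint adj₁
  have := hC.1.1
  exact preservesCoproducts_of_adjunction hD.1 adj₁ fun t ht ↦ ht.map hC hD F

theorem exists_adjoints (hF : PreservesCoproducts F) :
    ∃ (G : C ⥤ D) (H : D ⥤ C), Nonempty (F ⊣ G) ∧ Nonempty (G ⊣ H) := by
  have := isLeftAdjoint_of_preservesCoproducts hD.1 F hF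
  let adj₁ := Adjunction.ofIsLeftAdjoint F
  obtain ⟨_, _⟩ := exists_isTriangulated_rightAdjoint adj₁
  have := isLeftAdjoint_of_preservesCoproducts hC.1 F.rightAdjoint
    (preservesCoproducts_rightAdjoint hC hD adj₁)
  exact ⟨_, _, ⟨adj₁⟩, ⟨Adjunction.ofIsLeftAdjoint F.rightAdjoint⟩⟩

end Adjoints

section Wirthmuller

variable {C : Type u₁} [Category.{v} C] [HasZeroObject C] [Preadditive C] [HasShift C ℤ]
  [∀ n : ℤ, (shiftFunctor C n).Additive] [Pretriangulated C]
  [MonoidalCategory C] [SymmetricCategory C] [MonoidalClosed C]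
  {D : Type u₂} [Category.{v} D] [Preadditive D]
  [MonoidalCategory D] [SymmetricCategory D] [MonoidalClosed D]
  (hC : IsRigidlyCompactlyGenerated C) (hD : IsRigidlyCompactlyGenerated D)
  {F : D ⥤ C} [F.Braided] {G : C ⥤ D} {H : D ⥤ C}

include hC hD

theorem isIso_coWirthNat {adj₁ : F ⊣ G} {π : ProjIso F G}
    (hπ : ∀ x y, (π.hom.app x).app y = projMap adj₁ x y) (adj₂ : G ⊣ H)
    (hG : ∀ c : C, IsCompactObj c → IsCompactObj (G.obj c)) : IsIso (coWirthNat π adj₂) := by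
  rw [NatTrans.isIso_iff_isIso_app]
  refine fun y ↦ hC.1.isIso_of_bijective _ fun c hc ↦ ?_
  have hc := (hC.2 c).1 hc
  let c' := (ihom c).obj (𝟙_ C)
  let : ExactPairing c' c := hc.dualExactPairing
  let := ((hD.2 _).1 (hG _ ((hC.2 _).2 hc.dual))).exactPairing
  let e : (c ⟶ F.obj y) ≃ (c ⟶ (H ⋙ ihom (dualizingObj H)).obj y) :=
    (Equiv.ofBijective _ (bijective_map_comp_grothTrace hπ adj₂ c c' ((ihom (G.obj c')).obj (𝟙_ D))
      y)).trans ((adj₂.homEquiv _ _).trans ((ihom.adjunction (dualizingObj H)).homEquiv _ _))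
  convert e.bijective using 1
  ext g
  dsimp only [coWirthNat, e, Equiv.trans_apply, Equiv.ofBijective_apply]
  rw [← MonoidalClosed.curry_natural_left, grothMap_eq, ← adj₂.homEquiv_naturality_left]
  rfl

end Wirthmuller

section Compactness

variable {C : Type u₁} [Category.{v} C] [MonoidalCategory C] [SymmetricCategory C]
  {D : Type u₂} [Category.{v} D] [HasZeroObject D] [Preadditive D] [HasShift D ℤ]
  [∀ n : ℤ, (shiftFunctor D n).Additive] [Pretriangulated D] [IsTriangulated D]
  [MonoidalCategory D] [SymmetricCategory D] [MonoidalClosed D]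
  [MonoidalPreadditive D] [(curriedTensor D).CommShift₂Int] [TensorTriangulated D]

theorem isCompactObj_rightAdjoint_of_preservesProducts (hD : IsRigidlyCompactlyGenerated D)
    {F : D ⥤ C} {G : C ⥤ D} (adj₁ : F ⊣ G) (π : ProjIso F G) (hF : PreservesProducts F)
    (c c' : C) [ExactPairing c c'] : IsCompactObj (G.obj c) := by
  -- `Hom(𝟙, - ⊗ f_* c)` preserves products since `- ⊗ f_* c ≅ f_* (c ⊗ f^* -)`, and coproducts
  -- since `𝟙` is compact, so it is corepresented by a compact object.
  let e : F ⋙ tensorLeft c ⋙ G ≅ tensorRight (G.obj c) :=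
    NatIso.ofComponents
      (fun y ↦ G.mapIso (β_ _ _) ≪≫ ((π.app y).app c).symm) (fun {y y'} f ↦ by
        have h := congr_app (π.inv.naturality f) c
        dsimp at h ⊢
        rw [Category.assoc, ← h, ← G.map_comp_assoc, ← G.map_comp_assoc,
          BraidedCategory.braiding_naturality_right])
  have h : PreservesProducts (tensorRight (G.obj c)) :=
    (hF.comp ((preservesProducts_rightAdjoint (tensorLeftAdjunction c c')).comp
      (preservesProducts_rightAdjoint adj₁))).of_iso e
  obtain ⟨z, hz, u, hu⟩ := hD.1.exists_corepresenting
    (M := tensorRight (G.obj c) ⋙ preadditiveCoyoneda.obj (op (𝟙_ D)))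
    ((preservesCoproducts_leftAdjoint (tensorRightAdj _)).comp ((hD.2 _).2 isRigidObj_unit))
    (h.comp fun J ↦ inferInstance)
  exact hD.isCompactObj_of_corepresents hz hu

end Compactness

section TriangulatedDuality

variable {C : Type u₁} [Category.{v} C] [HasZeroObject C] [Preadditive C] [HasShift C ℤ]
  [∀ n : ℤ, (shiftFunctor C n).Additive] [Pretriangulated C] [IsTriangulated C]
  [MonoidalCategory C] [SymmetricCategory C] [MonoidalClosed C]
  [MonoidalPreadditive C] [(curriedTensor C).CommShift₂Int] [TensorTriangulated C]
  {D : Type u₂} [Category.{v} D] [HasZeroObject D] [Preadditive D] [HasShift D ℤ]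
  [∀ n : ℤ, (shiftFunctor D n).Additive] [Pretriangulated D] [IsTriangulated D]
  [MonoidalCategory D] [SymmetricCategory D] [MonoidalClosed D]
  [MonoidalPreadditive D] [(curriedTensor D).CommShift₂Int] [TensorTriangulated D]
  (hC : IsRigidlyCompactlyGenerated C) (hD : IsRigidlyCompactlyGenerated D)
  {F : D ⥤ C} [F.Braided] [F.CommShift ℤ] [F.IsTriangulated] (hF : PreservesCoproducts F)
  {G : C ⥤ D} {H : D ⥤ C}

include hC hD hF

theorem isIso_projMap (adj₁ : F ⊣ G) (x : D) (y : C) : IsIso (projMap adj₁ x y) := by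
  obtain ⟨_, _⟩ := exists_isTriangulated_rightAdjoint adj₁
  let τ : tensorRight (G.obj y) ⟶ F ⋙ tensorRight y ⋙ G :=
    { app x := projMap adj₁ x y
      naturality _ _ f := projMap_naturality_left adj₁ f y }
  exact hD.1.isIso_app_of_isTriangulated hD.1 (preservesCoproducts_leftAdjoint (tensorRightAdj _))
    (hF.comp ((preservesCoproducts_leftAdjoint (tensorRightAdj _)).comp
      (preservesCoproducts_rightAdjoint hC hD adj₁))) τ
    (fun t ht ↦
      letI := ((hD.2 t).1 ht).exactPairing
      isIso_projMap_of_exactPairing adj₁ t ((ihom t).obj (𝟙_ D)) y) x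

theorem isIso_genGrothMap {adj₁ : F ⊣ G} {π : ProjIso F G}
    (hπ : ∀ x y, (π.hom.app x).app y = projMap adj₁ x y) (adj₂ : G ⊣ H)
    (hH : PreservesCoproducts H) (x y : D) : IsIso (genGrothMap π adj₂ x y) := by
  obtain ⟨_, _⟩ := exists_isTriangulated_rightAdjoint adj₁
  obtain ⟨_, _⟩ := exists_isTriangulated_rightAdjoint adj₂
  let τ : F ⋙ tensorLeft (H.obj x) ⟶ tensorLeft x ⋙ H :=
    { app y := genGrothMap π adj₂ x y
      naturality _ _ f := genGrothMap_naturality_right π adj₂ x f }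
  exact hD.1.isIso_app_of_isTriangulated hC.1
    (hF.comp (preservesCoproducts_leftAdjoint (ihom.adjunction _)))
    ((preservesCoproducts_leftAdjoint (ihom.adjunction _)).comp hH) τ
    (fun t ht ↦
      letI := ((hD.2 t).1 ht).exactPairing
      isIso_genGrothMap_of_exactPairing hπ adj₂ x t ((ihom t).obj (𝟙_ D))) y

end TriangulatedDuality

section Conjugates

/-- Conjugates of a natural isomorphism of bifunctors with parametrized right adjoints. -/
def conjugateNatIso {P : Type*} [Category* P] {X : Type*} [Category* X] {Y : Type*} [Category* Y]
    {A B : P ⥤ X ⥤ Y} {R S : Pᵒᵖ ⥤ Y ⥤ X}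
    (a : ∀ p, A.obj p ⊣ R.obj (op p)) (b : ∀ p, B.obj p ⊣ S.obj (op p))
    (ha : ∀ {p p' : P} (f : p ⟶ p'), conjugateEquiv (a p') (a p) (A.map f) = R.map f.op)
    (hb : ∀ {p p' : P} (f : p ⟶ p'), conjugateEquiv (b p') (b p) (B.map f) = S.map f.op)
    (τ : B ≅ A) : R ≅ S :=
  NatIso.ofComponents (fun p ↦ conjugateIsoEquiv (a p.unop) (b p.unop) (τ.app p.unop))
    fun {p p'} f ↦ by
      change R.map f.unop.op ≫ conjugateEquiv (a _) (b _) (τ.hom.app _) =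
        conjugateEquiv (a _) (b _) (τ.hom.app _) ≫ S.map f.unop.op
      rw [← ha, ← hb, conjugateEquiv_comp, conjugateEquiv_comp, τ.hom.naturality]

variable {C : Type u} [Category.{v} C] [MonoidalCategory C] [SymmetricCategory C]
  [MonoidalClosed C]

lemma conjugateEquiv_tensorRightAdj {x y : C} (f : x ⟶ y) :
    conjugateEquiv (tensorRightAdj y) (tensorRightAdj x) ((curriedTensor C).flip.map f) =
      MonoidalClosed.pre f := by
  ext z
  simp only [conjugateEquiv_apply_app, MonoidalClosed.pre, tensorRightAdj,
    Adjunction.ofNatIsoLeft_unit, Adjunction.ofNatIsoLeft_counit]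
  simp [← Functor.map_comp]

lemma conjugateEquiv_whiskerLeft_tensorRightAdj {D : Type*} [Category* D]
    {A : D ⥤ C} {B : C ⥤ D} {A' : C ⥤ D} {B' : D ⥤ C}
    (a : A ⊣ B) (a' : A' ⊣ B') {x y : C} (f : x ⟶ y) :
    conjugateEquiv ((a.comp (tensorRightAdj y)).comp a') ((a.comp (tensorRightAdj x)).comp a')
      (Functor.whiskerRight (Functor.whiskerLeft A ((curriedTensor C).flip.map f)) A') =
        Functor.whiskerLeft B' (Functor.whiskerRight (MonoidalClosed.pre f) B) := by
  rw [conjugateEquiv_whiskerRight, conjugateEquiv_whiskerLeft, conjugateEquiv_tensorRightAdj]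

end Conjugates

section DualityIsos

open Functor MonoidalClosed

variable {C : Type u₁} [Category.{v} C] [MonoidalCategory C] [SymmetricCategory C]
  {D : Type u₂} [Category.{v} D] [MonoidalCategory D] [SymmetricCategory D]
  {F : D ⥤ C} {G : C ⥤ D} {H : D ⥤ C} {L K : C ⥤ D}

/-- Generalized Grothendieck duality as a natural isomorphism. -/
def genGrothIso (π : ProjIso F G) (adj₂ : G ⊣ H) (h : ∀ x y, IsIso (genGrothMap π adj₂ x y)) :
    H ⋙ curriedTensor C ⋙ (whiskeringLeft D C C).obj F ≅
      curriedTensor D ⋙ (whiskeringRight D D C).obj H :=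
  NatIso.ofComponents
    (fun x ↦ NatIso.ofComponents (fun y ↦ @asIso _ _ _ _ _ (h x y))
      (fun f ↦ genGrothMap_naturality_right π adj₂ x f)) fun f ↦ by
    ext y
    exact genGrothMap_naturality_left π adj₂ f y

/-- The left projection formula, transported from the right one. -/
def leftProjIso (π : ProjIso F G) (W : tensorLeft (dualizingObj H) ⋙ G ≅ L) :
    curriedTensor D ⋙ (whiskeringLeft C D D).obj L ≅
      F ⋙ curriedTensor C ⋙ (whiskeringRight C C D).obj L :=
  NatIso.ofComponents
    (fun x ↦ NatIso.ofComponents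
      (fun y ↦ whiskerLeftIso x (W.symm.app y) ≪≫ (π.app x).app _ ≪≫
        G.mapIso (swapIso (F.obj x) (dualizingObj H) y) ≪≫ W.app (F.obj x ⊗ y)) (fun {y y'} f ↦ by
        have h₁ := W.inv.naturality f
        have h₂ := (π.hom.app x).naturality (dualizingObj H ◁ f)
        have h₃ := W.hom.naturality (F.obj x ◁ f)
        dsimp at h₁ h₂ h₃ ⊢
        simp only [Category.assoc, whiskerLeftIso_hom, Iso.app_hom, Iso.symm_hom]
        rw [← h₃, ← G.map_comp_assoc, ← swapIso_naturality_right, G.map_comp_assoc,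
          ← reassoc_of% h₂, ← MonoidalCategory.whiskerLeft_comp_assoc,
          ← MonoidalCategory.whiskerLeft_comp_assoc, h₁]))
    fun {x x'} f ↦ by
      ext y
      have h₂ := congr_app (π.hom.naturality f) (dualizingObj H ⊗ y)
      have h₃ := W.hom.naturality (F.map f ▷ y)
      dsimp at h₂ h₃ ⊢
      simp only [Category.assoc, whiskerLeftIso_hom, Iso.app_hom, Iso.symm_hom]
      rw [← h₃, ← G.map_comp_assoc, ← swapIso_naturality_left, G.map_comp_assoc,
        ← reassoc_of% h₂, whisker_exchange_assoc]

/-- The isomorphism `f_{(1)} (f^* x ⊗ y) ≅ f_* (f^{(1)} x ⊗ y)`. -/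
def mixedIso (gr : F ⋙ tensorLeft (dualizingObj H) ≅ H)
    (W : tensorLeft (dualizingObj H) ⋙ G ≅ L) :
    F ⋙ curriedTensor C ⋙ (whiskeringRight C C D).obj L ≅
      H ⋙ curriedTensor C ⋙ (whiskeringRight C C D).obj G :=
  NatIso.ofComponents
    (fun x ↦ NatIso.ofComponents
      (fun y ↦ W.symm.app (F.obj x ⊗ y) ≪≫ G.mapIso (α_ (dualizingObj H) (F.obj x) y).symm ≪≫
        G.mapIso (whiskerRightIso (gr.app x) y)) (fun {y y'} f ↦ by
        have h := W.inv.naturality (F.obj x ◁ f)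
        dsimp at h ⊢
        simp only [Category.assoc, reassoc_of% h, ← G.map_comp, whiskerRightIso_hom, Iso.app_hom]
        rw [associator_inv_naturality_right_assoc, whisker_exchange]))
    fun {x x'} f ↦ by
      ext y
      have h := W.inv.naturality (F.map f ▷ y)
      have h' := gr.hom.naturality f
      dsimp at h h' ⊢
      simp only [Category.assoc, reassoc_of% h, ← G.map_comp, whiskerRightIso_hom, Iso.app_hom]
      rw [associator_inv_naturality_middle_assoc, ← comp_whiskerRight, h', comp_whiskerRight]

variable [MonoidalClosed C] [MonoidalClosed D]

/-- `[x, f_{(-1)} y] ≅ f_* [f^{(1)} x, y]`, by passing to right adjoints in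
`f^{(1)} x ⊗ f^* y ≅ f^{(1)} (x ⊗ y)` with `x` fixed. -/
def genCoGrothIso (adj₁ : F ⊣ G) (adj₃ : H ⊣ K)
    (τ : H ⋙ curriedTensor C ⋙ (whiskeringLeft D C C).obj F ≅
      curriedTensor D ⋙ (whiskeringRight D D C).obj H) :
    internalHom ⋙ (whiskeringLeft C D D).obj K ≅
      H.op ⋙ internalHom ⋙ (whiskeringRight C C D).obj G :=
  conjugateNatIso
    (A := curriedTensor D ⋙ (whiskeringRight D D C).obj H)
    (B := H ⋙ curriedTensor C ⋙ (whiskeringLeft D C C).obj F)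
    (fun x ↦ (ihom.adjunction x).comp adj₃)
    (fun x ↦ adj₁.comp (ihom.adjunction (H.obj x)))
    (fun f ↦ conjugateEquiv_whiskerRight (ihom.adjunction _) (ihom.adjunction _) adj₃
      ((curriedTensor D).map f))
    (fun f ↦ conjugateEquiv_whiskerLeft (ihom.adjunction _) (ihom.adjunction _) adj₁
      ((curriedTensor C).map (H.map f)))
    τ

/-- `[x, f_{(-1)} y] ≅ f_{(-1)} [f^* x, y]`, by passing to right adjoints in
`f^{(1)} y ⊗ f^* x ≅ f^{(1)} (y ⊗ x)` with `x` fixed. -/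
def pseudoInthomIso (adj₃ : H ⊣ K)
    (τ : H ⋙ curriedTensor C ⋙ (whiskeringLeft D C C).obj F ≅
      curriedTensor D ⋙ (whiskeringRight D D C).obj H) :
    internalHom ⋙ (whiskeringLeft C D D).obj K ≅
      F.op ⋙ internalHom ⋙ (whiskeringRight C C D).obj K :=
  conjugateNatIso
    (A := (curriedTensor D ⋙ (whiskeringRight D D C).obj H).flip)
    (B := (H ⋙ curriedTensor C ⋙ (whiskeringLeft D C C).obj F).flip)
    (fun x ↦ (tensorRightAdj x).comp adj₃)
    (fun x ↦ adj₃.comp (tensorRightAdj (F.obj x)))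
    (fun f ↦ (conjugateEquiv_whiskerRight (tensorRightAdj _) (tensorRightAdj _) adj₃
      ((curriedTensor D).flip.map f)).trans (by rw [conjugateEquiv_tensorRightAdj]; rfl))
    (fun f ↦ (conjugateEquiv_whiskerLeft (tensorRightAdj _) (tensorRightAdj _) adj₃
      ((curriedTensor C).flip.map (F.map f))).trans (by rw [conjugateEquiv_tensorRightAdj]; rfl))
    ((flipFunctor D D C).mapIso τ)

/-- `f^* [x, y] ≅ [f^* x, f^* y]`, by passing to right adjoints in
`x ⊗ f_{(1)} y ≅ f_{(1)} (f^* x ⊗ y)` with `x` fixed. -/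
def closedIso (adj₀ : L ⊣ F)
    (τ : curriedTensor D ⋙ (whiskeringLeft C D D).obj L ≅
      F ⋙ curriedTensor C ⋙ (whiskeringRight C C D).obj L) :
    internalHom ⋙ (whiskeringRight D D C).obj F ≅
      F.op ⋙ internalHom ⋙ (whiskeringLeft D C C).obj F :=
  conjugateNatIso
    (A := curriedTensor D ⋙ (whiskeringLeft C D D).obj L)
    (B := F ⋙ curriedTensor C ⋙ (whiskeringRight C C D).obj L)
    (fun x ↦ adj₀.comp (ihom.adjunction x))
    (fun x ↦ (ihom.adjunction (F.obj x)).comp adj₀)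
    (fun f ↦ conjugateEquiv_whiskerLeft (ihom.adjunction _) (ihom.adjunction _) adj₀
      ((curriedTensor D).map f))
    (fun f ↦ conjugateEquiv_whiskerRight (ihom.adjunction _) (ihom.adjunction _) adj₀
      ((curriedTensor C).map (F.map f)))
    τ.symm

/-- `[f_{(1)} x, y] ≅ f_* [x, f^* y]`, by passing to right adjoints in
`y ⊗ f_{(1)} x ≅ f_{(1)} (f^* y ⊗ x)` with `x` fixed. -/
def coLeftProjIso (adj₀ : L ⊣ F) (adj₁ : F ⊣ G)
    (τ : curriedTensor D ⋙ (whiskeringLeft C D D).obj L ≅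
      F ⋙ curriedTensor C ⋙ (whiskeringRight C C D).obj L) :
    L.op ⋙ internalHom ≅
      internalHom ⋙ (whiskeringLeft D C C).obj F ⋙ (whiskeringRight D C D).obj G :=
  conjugateNatIso
    (A := (curriedTensor D ⋙ (whiskeringLeft C D D).obj L).flip)
    (B := (F ⋙ curriedTensor C ⋙ (whiskeringRight C C D).obj L).flip)
    (fun x ↦ tensorRightAdj (L.obj x))
    (fun x ↦ (adj₁.comp (tensorRightAdj x)).comp adj₀)
    (fun f ↦ conjugateEquiv_tensorRightAdj (L.map f))
    (fun f ↦ conjugateEquiv_whiskerLeft_tensorRightAdj adj₁ adj₀ f)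
    ((flipFunctor D C D).mapIso τ).symm

/-- `[f^* x, f^* y] ≅ [f^{(1)} x, f^{(1)} y]`, by passing to right adjoints in
`f_{(1)} (f^* x ⊗ y) ≅ f_* (f^{(1)} x ⊗ y)` with `x` fixed. -/
def mixedHomIso (adj₀ : L ⊣ F) (adj₂ : G ⊣ H)
    (τ : F ⋙ curriedTensor C ⋙ (whiskeringRight C C D).obj L ≅
      H ⋙ curriedTensor C ⋙ (whiskeringRight C C D).obj G) :
    F.op ⋙ internalHom ⋙ (whiskeringLeft D C C).obj F ≅
      H.op ⋙ internalHom ⋙ (whiskeringLeft D C C).obj H :=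
  conjugateNatIso
    (A := F ⋙ curriedTensor C ⋙ (whiskeringRight C C D).obj L)
    (B := H ⋙ curriedTensor C ⋙ (whiskeringRight C C D).obj G)
    (fun x ↦ (ihom.adjunction (F.obj x)).comp adj₀)
    (fun x ↦ (ihom.adjunction (H.obj x)).comp adj₂)
    (fun f ↦ conjugateEquiv_whiskerRight (ihom.adjunction _) (ihom.adjunction _) adj₀
      ((curriedTensor C).map (F.map f)))
    (fun f ↦ conjugateEquiv_whiskerRight (ihom.adjunction _) (ihom.adjunction _) adj₂
      ((curriedTensor C).map (H.map f)))
    τ.symm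

/-- `f_* [x, f^* y] ≅ f_{(-1)} [x, f^{(1)} y]`, by passing to right adjoints in
`f_{(1)} (f^* y ⊗ x) ≅ f_* (f^{(1)} y ⊗ x)` with `x` fixed. -/
def mixedPushIso (adj₀ : L ⊣ F) (adj₁ : F ⊣ G) (adj₂ : G ⊣ H) (adj₃ : H ⊣ K)
    (τ : F ⋙ curriedTensor C ⋙ (whiskeringRight C C D).obj L ≅
      H ⋙ curriedTensor C ⋙ (whiskeringRight C C D).obj G) :
    internalHom ⋙ (whiskeringLeft D C C).obj F ⋙ (whiskeringRight D C D).obj G ≅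
      internalHom ⋙ (whiskeringLeft D C C).obj H ⋙ (whiskeringRight D C D).obj K :=
  conjugateNatIso
    (A := (F ⋙ curriedTensor C ⋙ (whiskeringRight C C D).obj L).flip)
    (B := (H ⋙ curriedTensor C ⋙ (whiskeringRight C C D).obj G).flip)
    (fun x ↦ (adj₁.comp (tensorRightAdj x)).comp adj₀)
    (fun x ↦ (adj₃.comp (tensorRightAdj x)).comp adj₂)
    (fun f ↦ conjugateEquiv_whiskerLeft_tensorRightAdj adj₁ adj₀ f)
    (fun f ↦ conjugateEquiv_whiskerLeft_tensorRightAdj adj₃ adj₂ f)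
    ((flipFunctor D C D).mapIso τ).symm

/-- The canonical isomorphisms, from generalized Grothendieck duality and the ur-Wirthmüller
isomorphism. -/
def dualityIsos [F.Braided] (π : ProjIso F G) (adj₀ : L ⊣ F) (adj₁ : F ⊣ G) (adj₂ : G ⊣ H)
    (adj₃ : H ⊣ K) (h : ∀ x y, IsIso (genGrothMap π adj₂ x y)) [IsIso (coWirthNat π adj₂)] :
    DualityIsos π adj₀ adj₁ adj₂ adj₃ :=
  have := isIso_grothNat π adj₂ (h _)
  have := isIso_urWirthNat π adj₀ adj₂
  let groth := asIso (grothNat π adj₂)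
  let urWirth := asIso (urWirthNat π adj₀ adj₂)
  let coWirth := conjugateIsoEquiv adj₀ ((ihom.adjunction (dualizingObj H)).comp adj₂) urWirth
  let leftProj := leftProjIso π urWirth
  let mixed := mixedIso groth urWirth
  { groth
    groth_hom _ := rfl
    coGroth := conjugateIsoEquiv adj₃ (adj₁.comp (ihom.adjunction (dualizingObj H))) groth
    coGroth_hom := rfl
    genGroth := genGrothIso π adj₂ h
    genGroth_hom _ _ := rfl
    genCoGroth := genCoGrothIso adj₁ adj₃ (genGrothIso π adj₂ h)
    genCoGroth_hom _ := rfl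
    pseudoInthom := pseudoInthomIso adj₃ (genGrothIso π adj₂ h)
    pseudoInthom_hom _ := rfl
    urWirth
    urWirth_hom _ := rfl
    coWirth
    coWirth_hom := rfl
    leftProj
    leftProj_hom x y := by
      simp [leftProj, leftProjIso, ← MonoidalCategory.whiskerLeft_comp_assoc]
    closed := closedIso adj₀ leftProj
    closed_hom _ := rfl
    coLeftProj := coLeftProjIso adj₀ adj₁ leftProj
    coLeftProj_hom _ := rfl
    mixed
    mixed_hom _ _ := rfl
    mixedHom := mixedHomIso adj₀ adj₂ mixed
    mixedHom_hom _ := rfl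
    mixedPush := mixedPushIso adj₀ adj₁ adj₂ adj₃ mixed
    mixedPush_hom _ := rfl
    coWirthGroth := coWirth ≪≫ isoWhiskerRight groth.symm (ihom (dualizingObj H))
    coWirthGroth_hom _ := rfl
    unitIso := Functor.Monoidal.εIso F ≪≫ coWirth.app (𝟙_ D)
    unitIso_hom := rfl }

end DualityIsos

section Equivalence

variable {C : Type u₁} [Category.{v} C] [HasZeroObject C] [Preadditive C] [HasShift C ℤ]
  [∀ n : ℤ, (shiftFunctor C n).Additive] [Pretriangulated C] [IsTriangulated C]
  [MonoidalCategory C] [SymmetricCategory C] [MonoidalClosed C]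
  [MonoidalPreadditive C] [(curriedTensor C).CommShift₂Int] [TensorTriangulated C]
  {D : Type u₂} [Category.{v} D] [HasZeroObject D] [Preadditive D] [HasShift D ℤ]
  [∀ n : ℤ, (shiftFunctor D n).Additive] [Pretriangulated D] [IsTriangulated D]
  [MonoidalCategory D] [SymmetricCategory D] [MonoidalClosed D]
  [MonoidalPreadditive D] [(curriedTensor D).CommShift₂Int] [TensorTriangulated D]
  (hC : IsRigidlyCompactlyGenerated C) (hD : IsRigidlyCompactlyGenerated D)
  {F : D ⥤ C} [F.Braided] [F.CommShift ℤ] [F.IsTriangulated] (hF : PreservesCoproducts F)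
  {G : C ⥤ D} {H : D ⥤ C}

include hC hD hF

theorem tfae_isRightAdjoint {adj₁ : F ⊣ G} {π : ProjIso F G}
    (hπ : ∀ x y, (π.hom.app x).app y = projMap adj₁ x y) (adj₂ : G ⊣ H) :
    List.TFAE [
      F.IsRightAdjoint,
      PreservesProducts F,
      H.IsLeftAdjoint,
      PreservesCoproducts H,
      ∀ c : C, IsCompactObj c → IsCompactObj (G.obj c),
      Nonempty (F ⋙ tensorLeft (dualizingObj H) ≅ H)] := by
  obtain ⟨_, _⟩ := exists_isTriangulated_rightAdjoint adj₁
  obtain ⟨_, _⟩ := exists_isTriangulated_rightAdjoint adj₂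
  have := hC.1.1
  have := hD.1.1
  tfae_have 1 → 2 := fun _ ↦ preservesProducts_rightAdjoint (Adjunction.ofIsRightAdjoint F)
  tfae_have 2 → 5 := fun h c hc ↦
    letI := ((hC.2 c).1 hc).exactPairing
    isCompactObj_rightAdjoint_of_preservesProducts hD adj₁ π h c ((ihom c).obj (𝟙_ C))
  tfae_have 5 → 1 := fun h ↦
    have := isIso_coWirthNat hC hD hπ adj₂ h
    (((ihom.adjunction (dualizingObj H)).comp adj₂).ofNatIsoRight
      (asIso (coWirthNat π adj₂)).symm).isRightAdjoint
  tfae_have 5 → 4 := preservesCoproducts_of_adjunction hC.1 adj₂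
  tfae_have 4 → 5 := fun h c hc ↦ hc.of_adjunction adj₂ h
  tfae_have 4 → 3 := isLeftAdjoint_of_preservesCoproducts hD.1 H
  tfae_have 3 → 4 := fun _ ↦ preservesCoproducts_leftAdjoint (Adjunction.ofIsLeftAdjoint H)
  tfae_have 4 → 6 := fun h ↦
    have := isIso_grothNat π adj₂ (isIso_genGrothMap hC hD hF hπ adj₂ h _)
    ⟨asIso (grothNat π adj₂)⟩
  tfae_have 6 → 4 := fun ⟨e⟩ ↦
    (hF.comp (preservesCoproducts_leftAdjoint (ihom.adjunction _))).of_iso e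
  tfae_finish

end Equivalence

end GNDuality

end

open GNDuality in
theorem mainTheorem1
    {C : Type u₁} [Category.{v} C] [HasZeroObject C] [Preadditive C] [HasShift C ℤ]
    [∀ n : ℤ, (shiftFunctor C n).Additive] [Pretriangulated C] [IsTriangulated C]
    [MonoidalCategory C] [SymmetricCategory C] [MonoidalClosed C] [MonoidalPreadditive C]
    [(curriedTensor C).CommShift₂Int] [TensorTriangulated C]
    {D : Type u₂} [Category.{v} D] [HasZeroObject D] [Preadditive D] [HasShift D ℤ]
    [∀ n : ℤ, (shiftFunctor D n).Additive] [Pretriangulated D] [IsTriangulated D]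
    [MonoidalCategory D] [SymmetricCategory D] [MonoidalClosed D] [MonoidalPreadditive D]
    [(curriedTensor D).CommShift₂Int] [TensorTriangulated D]
    (hC : IsRigidlyCompactlyGenerated C) (hD : IsRigidlyCompactlyGenerated D)
    (F : D ⥤ C) [F.Braided] [F.CommShift ℤ] [F.IsTriangulated] (hF : PreservesCoproducts F) :
    (∃ (G : C ⥤ D) (H : D ⥤ C), Nonempty (F ⊣ G) ∧ Nonempty (G ⊣ H)) ∧
    ∀ (G : C ⥤ D) (H : D ⥤ C) (adj₁ : F ⊣ G) (adj₂ : G ⊣ H),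
      List.TFAE [
        F.IsRightAdjoint,
        PreservesProducts F,
        H.IsLeftAdjoint,
        PreservesCoproducts H,
        ∀ c : C, IsCompactObj c → IsCompactObj (G.obj c),
        Nonempty (F ⋙ tensorLeft (dualizingObj H) ≅ H)] ∧
      ∃ π : ProjIso F G,
        (∀ (x : D) (y : C), (π.hom.app x).app y = projMap adj₁ x y) ∧
        ∀ (L K : C ⥤ D) (adj₀ : L ⊣ F) (adj₃ : H ⊣ K),
          Nonempty (DualityIsos π adj₀ adj₁ adj₂ adj₃) := by
  refine ⟨exists_adjoints hC hD hF, fun G H adj₁ adj₂ ↦ ?_⟩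
  let π := projIso adj₁ (isIso_projMap hC hD hF adj₁)
  have hπ (x : D) (y : C) : (π.hom.app x).app y = projMap adj₁ x y := rfl
  have tfae := tfae_isRightAdjoint hC hD hF hπ adj₂
  refine ⟨tfae, π, hπ, fun L K adj₀ adj₃ ↦ ?_⟩
  have hH : PreservesCoproducts H := preservesCoproducts_leftAdjoint adj₃
  have := isIso_coWirthNat hC hD hπ adj₂ ((tfae.out 3 4).1 hH)
  exact ⟨dualityIsos π adj₀ adj₁ adj₂ adj₃ (isIso_genGrothMap hC hD hF hπ adj₂ hH)⟩
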